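/- Let $(R,\mathfrak m)$ be a Cohen–Macaulay local ring of Krull dimension $d\ge 2$, and let $I_1,I_2$ be $\mathfrak m$-primary ideals of $R$. Let $x_1,\dots,x_d\in I_2$ be such that $(\mathbf x)=(x_1,\dots,x_d)$ is a minimal reduction of $I_2$ and $x_1,\dots,x_d$ is a superficial sequence for $I_2$ and $I_1$. The latter means that for each $i$ the images $\bar x_i,\bar I_1,\bar I_2$ in $\bar R=R/(x_1,\dots,x_{i-1})$ satisfy: $\bar x_i\in\bar I_2$, and there is $r_0\geq 1$ such that $\bar x_i\bar R\cap \bar I_1^{\,s}\bar I_2^{\,r}=\bar x_i\bar I_1^{\,s}\bar I_2^{\,r-1}$ for all $r\ge r_0$ and all $s\ge 0$. Use the convention $I_2^n=R$ for $n\le 0$, and for $n\in\mathbb Z$ put $H(1,n)=\ell(R/I_1I_2^n)$. Let $C(\mathbf x,(1,n))$ be the complex $$0\to \frac{R}{I_1I_2^{n-d}}\to\cdots\to\left(\frac{R}{I_1I_2^{n-i}}\right)^{\binom di}\to\cdots\to\left(\frac{R}{I_1I_2^{n-1}}\right)^{d}\to\frac{R}{I_1I_2^n}\to 0$$ with $R/I_1I_2^n$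 in degree $0$, whose maps are induced by the Koszul complex of $x_1,\dots,x_d$ on $R$, and let $h_i(C,\mathbf x)(1,n)$ be the length of its $i$-th homology module. For a function $f$ on $\mathbb Z$ put $(\Delta f)(n)=f(n)-f(n-1)$. Then all the lengths $H(1,n)$ are finite, and there is a unique polynomial $P(1,n)$ in $n$ with rational coefficients such that $P(1,n)=H(1,n)$ for all large $n$. For every $n\ge 1$ all the lengths occurring below are finite, and $$\Delta^d\bigl[P(1,n)-H(1,n)\bigr]=\ell\!\left(\frac{I_1I_2^n+(\mathbf x)}{(\mathbf x)}\right)-\sum_{i=1}^d(-1)^i\,h_i(C,\mathbf x)(1,n) =\ell\!\left(\frac{I_1I_2^n}{(\mathbf x)I_1I_2^{n-1}}\right)-\sum_{i=2}^d(-1)^i\,h_i(C,\mathbf x)(1,n).$$ -/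

import Mathlib

universe u

/-- A Cohen-Macaulay local ring: a Noetherian local ring that has a regular sequence
whose length is the Krull dimension (that is, its depth equals its dimension). -/
structure IsCohenMacaulayLocalRing (R : Type u) [CommRing R] [IsLocalRing R] : Prop where
  isNoetherianRing : IsNoetherianRing R
  exists_isRegular : ∃ rs : List R,
    RingTheory.Sequence.IsRegular R rs ∧ (rs.length : WithBot ℕ∞) = ringKrullDim R

namespace Ideal

variable {R : Type u} [CommRing R]

/-- `I` is primary to the maximal ideal of the local ring `R`. -/
def IsMaximalIdealPrimary [IsLocalRing R] (I : Ideal R) : Prop :=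
  I.IsPrimary ∧ I.radical = IsLocalRing.maximalIdeal R

/-- `J` is a reduction of `I`. -/
def IsReduction (J I : Ideal R) : Prop :=
  J ≤ I ∧ ∃ n : ℕ, J * I ^ n = I ^ (n + 1)

/-- `J` is a minimal reduction of `I`: it is minimal, for inclusion, among the reductions. -/
def IsMinimalReduction (J I : Ideal R) : Prop :=
  Minimal (fun K : Ideal R => K.IsReduction I) J

/-- `x ∈ I₂` is superficial for `I₂` and `I₁`: for all large `r` and all `s ≥ 0`,
`xR ∩ I₁ ^ s I₂ ^ r = x I₁ ^ s I₂ ^ (r - 1)`. -/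
def IsSuperficial (x : R) (I₂ I₁ : Ideal R) : Prop :=
  x ∈ I₂ ∧ ∃ r₀ : ℕ, 0 < r₀ ∧ ∀ r : ℕ, r₀ ≤ r → ∀ s : ℕ,
    Ideal.span {x} ⊓ I₁ ^ s * I₂ ^ r = Ideal.span {x} * (I₁ ^ s * I₂ ^ (r - 1))

/-- `x₁, …, x_k` is a superficial sequence for `I₂` and `I₁`: the image of each `x_i` in
`R / (x₁, …, x_{i-1})` is superficial for the images of `I₂` and `I₁`. -/
def IsSuperficialSequence {k : ℕ} (x : Fin k → R) (I₂ I₁ : Ideal R) : Prop :=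
  ∀ i : Fin k,
    let q := Ideal.Quotient.mk (Ideal.span (x '' {j | j < i}))
    IsSuperficial (q (x i)) (I₂.map q) (I₁.map q)

/-- The filtration `n ↦ I₁ I₂ ^ n`, `n ∈ ℤ`, where `I₂ ^ n = R` for `n ≤ 0`. -/
def prodFiltration (I₁ I₂ : Ideal R) (n : ℤ) : Ideal R :=
  I₁ * I₂ ^ n.toNat

/-- The Hilbert function `n ↦ ℓ(R / I₁ I₂ ^ n)`, `n ∈ ℤ`. -/
noncomputable def hilbertFn (I₁ I₂ : Ideal R) (n : ℤ) : ℕ :=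
  (Module.length R (R ⧸ prodFiltration I₁ I₂ n)).toNat

/-- `P` is the Hilbert polynomial: it agrees with `ℓ(R / I₁ I₂ ^ n)` for all large `n`. -/
def IsHilbertPolynomial (I₁ I₂ : Ideal R) (P : Polynomial ℚ) : Prop :=
  ∃ N : ℤ, ∀ n : ℤ, N ≤ n → P.eval (n : ℚ) = (hilbertFn I₁ I₂ n : ℚ)

theorem mul_mem_prodFiltration {I₁ I₂ : Ideal R} {a : R} (ha : a ∈ I₂) (n : ℤ) (i : ℕ) {y : R}
    (hy : y ∈ prodFiltration I₁ I₂ (n - ((i + 1 : ℕ) : ℤ))) :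
    a * y ∈ prodFiltration I₁ I₂ (n - (i : ℤ)) := by
  unfold prodFiltration at *
  have h1 : a * y ∈ I₂ * (I₁ * I₂ ^ (n - ((i + 1 : ℕ) : ℤ)).toNat) := Ideal.mul_mem_mul ha hy
  have h2 : I₂ * (I₁ * I₂ ^ (n - ((i + 1 : ℕ) : ℤ)).toNat)
      = I₁ * I₂ ^ ((n - ((i + 1 : ℕ) : ℤ)).toNat + 1) := by
    rw [pow_succ]; ring
  rw [h2] at h1
  exact Ideal.mul_mono_right (Ideal.pow_le_pow_right (by omega)) h1

/-- Multiplication by `a ∈ I₂`, as a map `R / I₁ I₂ ^ (n - i - 1) → R / I₁ I₂ ^ (n - i)`. -/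
def filtMul (I₁ I₂ : Ideal R) (n : ℤ) (i : ℕ) (a : R) (ha : a ∈ I₂) :
    (R ⧸ prodFiltration I₁ I₂ (n - ((i + 1 : ℕ) : ℤ))) →ₗ[R]
      (R ⧸ prodFiltration I₁ I₂ (n - (i : ℤ))) :=
  Submodule.mapQ _ _ (LinearMap.mulLeft R a) (fun _ hy => mul_mem_prodFiltration ha n i hy)

/-- The term `(R / I₁ I₂ ^ (n - i)) ^ (k choose i)` of the complex `C(x₁, …, x_k, (1, n))`;
its coordinates are indexed by the `i`-element subsets of the index set `Fin k`. -/
abbrev KoszulTerm (I₁ I₂ : Ideal R) (k : ℕ) (n : ℤ) (i : ℕ) : Type u :=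
  {S : Finset (Fin k) // S.card = i} → R ⧸ prodFiltration I₁ I₂ (n - (i : ℤ))

/-- The differential induced by the Koszul differential
`e_S ↦ ∑_{j ∈ S} (-1) ^ #{l ∈ S | l < j} x_j e_{S \ {j}}`; in coordinates, the coefficient of
`e_T` in the image of `f` is `∑_{j ∉ T} (-1) ^ #{l ∈ T | l < j} x_j f_{T ∪ {j}}`. -/
def koszulD (I₁ I₂ : Ideal R) {k : ℕ} (x : Fin k → R) (hx : ∀ j, x j ∈ I₂) (n : ℤ) (i : ℕ) :
    KoszulTerm I₁ I₂ k n (i + 1) →ₗ[R] KoszulTerm I₁ I₂ k n i :=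
  LinearMap.pi fun T => ∑ j : {j : Fin k // j ∉ T.1},
    ((-1 : R) ^ (T.1.filter (fun l => l < j.1)).card) •
      (filtMul I₁ I₂ n i (x j.1) (hx j.1)).comp
        (LinearMap.proj (⟨insert j.1 T.1, by rw [Finset.card_insert_of_notMem j.2, T.2]⟩ :
          {S : Finset (Fin k) // S.card = i + 1}))

theorem koszulD_apply_mk (I₁ I₂ : Ideal R) {k : ℕ} (x : Fin k → R) (hx : ∀ j, x j ∈ I₂)
    (n : ℤ) (i : ℕ) (g : Finset (Fin k) → R) (T : {S : Finset (Fin k) // S.card = i}) :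
    koszulD I₁ I₂ x hx n i (fun S => Submodule.Quotient.mk (g S.1)) T =
      Submodule.Quotient.mk (∑ j : Fin k, if j ∈ T.1 then 0 else
        (-1 : R) ^ (T.1.filter (fun l => l < j)).card * (x j * g (insert j T.1))) := by
  have h1 : (∑ j : Fin k, if j ∈ T.1 then (0 : R) else
        (-1 : R) ^ (T.1.filter (fun l => l < j)).card * (x j * g (insert j T.1))) =
      ∑ j : {j : Fin k // j ∉ T.1},
        (-1 : R) ^ (T.1.filter (fun l => l < j.1)).card * (x j.1 * g (insert j.1 T.1)) := by
    rw [← Finset.sum_subtype (Finset.univ.filter (fun j => j ∉ T.1)) (by simp)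
      (fun j => (-1 : R) ^ (T.1.filter (fun l => l < j)).card * (x j * g (insert j T.1))),
      Finset.sum_filter]
    refine Finset.sum_congr rfl fun j _ => ?_
    by_cases h : j ∈ T.1 <;> simp [h]
  rw [h1, ← Submodule.mkQ_apply, map_sum]
  simp only [koszulD, LinearMap.pi_apply, LinearMap.sum_apply]
  rfl

theorem koszul_sum_eq_zero {k : ℕ} (x : Fin k → R) (g : Finset (Fin k) → R)
    (T : Finset (Fin k)) :
    (∑ j : Fin k, if j ∈ T then (0 : R) else
      (-1 : R) ^ (T.filter (fun l => l < j)).card * (x j *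
        ∑ l : Fin k, if l ∈ insert j T then (0 : R) else
          (-1 : R) ^ ((insert j T).filter (fun m => m < l)).card *
            (x l * g (insert l (insert j T))))) = 0 := by
  have key : ∀ j l : Fin k, j ∉ T → l ∉ T → j < l →
      (-1 : R) ^ (T.filter (fun m => m < j)).card *
          (-1 : R) ^ ((insert j T).filter (fun m => m < l)).card +
        (-1 : R) ^ (T.filter (fun m => m < l)).card *
          (-1 : R) ^ ((insert l T).filter (fun m => m < j)).card = 0 := by
    intro j l hj hl hjl
    have h1 : ((insert j T).filter (fun m => m < l)).card
        = (T.filter (fun m => m < l)).card + 1 := by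
      rw [Finset.filter_insert, if_pos hjl, Finset.card_insert_of_notMem (by simp [hj])]
    have h2 : (insert l T).filter (fun m => m < j) = T.filter (fun m => m < j) := by
      rw [Finset.filter_insert, if_neg (not_lt.mpr hjl.le)]
    rw [h1, h2]; ring
  let F : Fin k × Fin k → R := fun p =>
    if p.1 ∈ T ∨ p.2 ∈ T ∨ p.1 = p.2 then 0 else
      ((-1 : R) ^ (T.filter (fun m => m < p.1)).card *
        (-1 : R) ^ ((insert p.1 T).filter (fun m => m < p.2)).card) *
          (x p.1 * x p.2 * g (insert p.2 (insert p.1 T)))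
  have hF : ∑ p : Fin k × Fin k, F p = 0 := by
    refine Finset.sum_involution (fun p _ => (p.2, p.1)) ?_ ?_ ?_ ?_
    · rintro ⟨j, l⟩ -
      simp only [F]
      by_cases h : j ∈ T ∨ l ∈ T ∨ j = l
      · have h' : l ∈ T ∨ j ∈ T ∨ l = j := by tauto
        rw [if_pos h, if_pos h', add_zero]
      · have h' : ¬ (l ∈ T ∨ j ∈ T ∨ l = j) := by tauto
        rw [if_neg h, if_neg h']
        push Not at h
        obtain ⟨hj, hl, hne⟩ := h
        rw [Finset.insert_comm j l T, mul_comm (x l) (x j), ← add_mul]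
        rcases lt_or_gt_of_ne hne with hlt | hlt
        · rw [key j l hj hl hlt, zero_mul]
        · rw [add_comm, key l j hl hj hlt, zero_mul]
    · rintro ⟨j, l⟩ - hne heq
      apply hne
      have : l = j := congrArg Prod.fst heq
      simp [F, this]
    · intro p _; exact Finset.mem_univ _
    · intro p _; rfl
  refine Eq.trans ?_ hF
  rw [Fintype.sum_prod_type]
  refine Finset.sum_congr rfl fun j _ => ?_
  by_cases hj : j ∈ T
  · simp [F, hj]
  · rw [if_neg hj, Finset.mul_sum, Finset.mul_sum]
    refine Finset.sum_congr rfl fun l _ => ?_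
    by_cases hl : l ∈ T
    · simp [F, hl]
    · by_cases hjl : j = l
      · subst hjl; simp [F]
      · have hlj : l ∉ insert j T := by simp [hl, Ne.symm hjl]
        simp only [F, hj, hl, hjl, hlj, if_false, or_self]
        ring

theorem koszulD_comp (I₁ I₂ : Ideal R) {k : ℕ} (x : Fin k → R) (hx : ∀ j, x j ∈ I₂)
    (n : ℤ) (i : ℕ) :
    (koszulD I₁ I₂ x hx n i).comp (koszulD I₁ I₂ x hx n (i + 1)) = 0 := by
  refine LinearMap.ext fun f => ?_
  have hf : ∃ g : Finset (Fin k) → R,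
      f = fun S : {S : Finset (Fin k) // S.card = i + 1 + 1} =>
        Submodule.Quotient.mk (g S.1) := by
    choose g hg using fun S : {S : Finset (Fin k) // S.card = i + 1 + 1} =>
      Submodule.Quotient.mk_surjective _ (f S)
    refine ⟨fun S => if h : S.card = i + 1 + 1 then g ⟨S, h⟩ else 0, ?_⟩
    funext S
    beta_reduce
    rw [dif_pos S.2]
    exact (hg S).symm
  obtain ⟨g, rfl⟩ := hf
  funext T
  rw [LinearMap.comp_apply]
  have h1 : koszulD I₁ I₂ x hx n (i + 1) (fun S => Submodule.Quotient.mk (g S.1)) =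
      fun S => Submodule.Quotient.mk ((fun U : Finset (Fin k) =>
        ∑ j : Fin k, if j ∈ U then (0 : R) else
        (-1 : R) ^ (U.filter (fun l => l < j)).card * (x j * g (insert j U))) S.1) := by
    funext S
    exact koszulD_apply_mk I₁ I₂ x hx n (i + 1) g S
  rw [h1]
  refine (koszulD_apply_mk I₁ I₂ x hx n i (fun U : Finset (Fin k) =>
    ∑ j : Fin k, if j ∈ U then (0 : R) else
      (-1 : R) ^ (U.filter (fun l => l < j)).card * (x j * g (insert j U))) T).trans ?_
  rw [koszul_sum_eq_zero]
  rfl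

/-- The complex `C(x₁, …, x_k, (1, n))`:
`0 → R / I₁ I₂ ^ (n - k) → ⋯ → (R / I₁ I₂ ^ (n - i)) ^ (k choose i) → ⋯ → R / I₁ I₂ ^ n → 0`,
with `R / I₁ I₂ ^ n` in degree `0` and the maps induced by the Koszul complex of `x₁, …, x_k`. -/
noncomputable def koszulFiltComplex (I₁ I₂ : Ideal R) {k : ℕ} (x : Fin k → R)
    (hx : ∀ j, x j ∈ I₂) (n : ℤ) : ChainComplex (ModuleCat.{u} R) ℕ :=
  ChainComplex.of (fun i => ModuleCat.of R (KoszulTerm I₁ I₂ k n i))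
    (fun i => ModuleCat.ofHom (koszulD I₁ I₂ x hx n i))
    (fun i => by
      rw [← ModuleCat.ofHom_comp, koszulD_comp]
      rfl)

/-- The homology `H_i(C(x₁, …, x_k, (1, n)))`. -/
noncomputable abbrev koszulFiltHomology (I₁ I₂ : Ideal R) {k : ℕ} (x : Fin k → R)
    (hx : ∀ j, x j ∈ I₂) (n : ℤ) (i : ℕ) : ModuleCat.{u} R :=
  (koszulFiltComplex I₁ I₂ x hx n).homology i

/-- `h_i(C, x₁, …, x_k)(1, n)`, the length of `H_i(C(x₁, …, x_k, (1, n)))`. -/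
noncomputable def koszulFiltLength (I₁ I₂ : Ideal R) {k : ℕ} (x : Fin k → R)
    (hx : ∀ j, x j ∈ I₂) (n : ℤ) (i : ℕ) : ℕ :=
  (Module.length R (koszulFiltHomology I₁ I₂ x hx n i)).toNat

/-- The length `ℓ(A / B)` in `ℕ∞` of the quotient of an ideal `A` by a subideal `B`. -/
noncomputable def quotLength (A B : Ideal R) : ℕ∞ :=
  Module.length R (A ⧸ Submodule.submoduleOf B A)

end Ideal

/-- The difference operator `(Δ f)(n) = f n - f (n - 1)`. -/
def backwardDiff (f : ℤ → ℚ) : ℤ → ℚ := fun n => f n - f (n - 1)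

/-! Both sides are compared through an Euler characteristic. Since the `i`-th term of `C(x, (1, n))`
is a sum of `d.choose i` copies of `R / I₁ I₂ ^ (n - i)`, the alternating sum of the lengths of its
terms is `Δ^d H(1, n)`; by additivity of length it is also `∑ (-1) ^ i h_i`
(`sum_choose_mul_hilbertFn_eq`). The degree-zero homology is `R / (I₁ I₂ ^ n + (x))`.

On the other side `Δ^d P` is the constant `ℓ(R / (x))`. The ring being Cohen-Macaulay and `(x)`
having radical the maximal ideal, `x` is a regular sequence. Multiplication by `x_k` modulo its
predecessors then gives exact sequences, for large `n` by superficiality, along which one difference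
of the Hilbert function amounts to killing one more `x_k`. After `d` differences only `ℓ(R / (x))`
is left (`eventually_backwardDiff_iterate_hilbertFn_eq`). This produces the polynomial `P`, and a
polynomial that is eventually constant is constant, so the value of `Δ^d P` holds for every `n`.

Subtracting, `ℓ(R / (x)) - h_0 = ℓ((I₁ I₂ ^ n + (x)) / (x))`, which is the first formula. For the
second, syzygies of a regular sequence are Koszul, so `H_1 = ((x) ∩ I₁ I₂ ^ n) / (x) I₁ I₂ ^ (n -
1)`, and `h_1` is exactly the difference between the two leading lengths
(`quotLength_add_koszulFiltLength_one`). -/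

section

/-! ### Systems of parameters in a Cohen-Macaulay local ring are regular sequences. -/

open RingTheory.Sequence IsLocalRing Pointwise

universe v

namespace IsSMulRegular

variable {R : Type*} [CommRing R] [IsNoetherianRing R] [IsLocalRing R]
  {M : Type*} [AddCommGroup M] [Module R M] [Module.Finite R M]

/-- If `y` is `M`-regular and `p` is associated to `M`, then some prime containing `p` and `y`
is associated to `M / yM`. -/
theorem exists_associatedPrime_quotSMulTop {y : R} (hreg : IsSMulRegular M y)
    (hy : y ∈ maximalIdeal R) {p : Ideal R} (hp : IsAssociatedPrime p M) :
    ∃ q : Ideal R, IsAssociatedPrime q (QuotSMulTop y M) ∧ p ≤ q ∧ y ∈ q := by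
  obtain ⟨_, u, hu⟩ := isAssociatedPrime_iff.mp hp
  set N : Submodule R M := Submodule.torsionBySet R M (p : Set R) with hN
  have huN : u ∈ N := by
    rw [hN, Submodule.mem_torsionBySet_iff]
    rintro ⟨a, ha⟩
    have ha' : a ∈ p := ha
    rw [hu, Submodule.mem_colon_singleton] at ha'
    simpa using ha'
  have hu0 : u ≠ 0 := by
    rintro rfl
    exact hp.isPrime.ne_top (by rw [hu, Ideal.eq_top_iff_one, Submodule.mem_colon_singleton]; simp)
  -- Nakayama: if every element of `N` were of the form `y • v`, regularity of `y` would put `v` in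
  -- `N` again. Then `N ≤ 𝔪 N`, forcing `N = 0` although `u ∈ N` is nonzero.
  have hex : ∃ w ∈ N, w ∉ y • (⊤ : Submodule R M) := by
    by_contra! hcon
    have hle : N ≤ maximalIdeal R • N := by
      intro w hw
      obtain ⟨v, -, rfl⟩ := (Submodule.mem_smul_pointwise_iff_exists _ _ _).mp (hcon w hw)
      refine Submodule.smul_mem_smul hy ?_
      rw [hN, Submodule.mem_torsionBySet_iff] at hw ⊢
      intro a
      refine hreg ?_
      change y • (a : R) • v = y • (0 : M)
      rw [smul_zero, smul_comm]
      exact hw a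
    have hbot := Submodule.eq_bot_of_le_smul_of_le_jacobson_bot (maximalIdeal R) N
      (IsNoetherian.noetherian N) hle (maximalIdeal_le_jacobson _)
    rw [hbot] at huN
    exact hu0 (by simpa using huN)
  obtain ⟨w, hwN, hw⟩ := hex
  obtain ⟨q, hq, hle⟩ := exists_le_isAssociatedPrime_of_isNoetherianRing R
    (M := QuotSMulTop y M) (Submodule.Quotient.mk w)
    (by rwa [Ne, Submodule.Quotient.mk_eq_zero])
  refine ⟨q, hq, fun a ha => hle ?_, hle ?_⟩
  · rw [Submodule.mem_colon_singleton]
    have := (Submodule.mem_torsionBySet_iff _ _).mp hwN ⟨a, ha⟩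
    change a • w = 0 at this
    rw [← Submodule.Quotient.mk_smul, this]
    simp
  · rw [Submodule.mem_colon_singleton, ← Submodule.Quotient.mk_smul, Submodule.mem_bot,
      Submodule.Quotient.mk_eq_zero]
    exact Submodule.smul_mem_pointwise_smul _ _ _ trivial

end IsSMulRegular

/-- An element of `q` outside `p` is a nonzero element of the domain `R ⧸ p`, hence a
non-zero-divisor, and killing a non-zero-divisor lowers the dimension by at least one. -/
theorem ringKrullDim_quotient_add_one_le_of_lt {R : Type*} [CommRing R] {p q : Ideal R}
    [p.IsPrime] (h : p < q) : ringKrullDim (R ⧸ q) + 1 ≤ ringKrullDim (R ⧸ p) := by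
  obtain ⟨y, hyq, hyp⟩ := SetLike.exists_of_lt h
  refine ringKrullDim_succ_le_of_surjective (Ideal.Quotient.factor h.le)
    (Ideal.Quotient.factor_surjective h.le) (r := Ideal.Quotient.mk p y) ?_ ?_
  · exact mem_nonZeroDivisors_of_ne_zero (by rwa [Ne, Ideal.Quotient.eq_zero_iff_mem])
  · rwa [Ideal.Quotient.factor_mk, Ideal.Quotient.eq_zero_iff_mem]

/-- The length of a regular sequence on `M` is at most `dim R / p` for every prime `p`
associated to `M`. -/
theorem RingTheory.Sequence.IsRegular.length_le_ringKrullDim_quotient {R : Type*} [CommRing R]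
    [IsNoetherianRing R] [IsLocalRing R] (rs : List R) : ∀ {M : Type v} [AddCommGroup M]
    [Module R M] [Module.Finite R M], IsRegular M rs → ∀ {p : Ideal R}, IsAssociatedPrime p M →
      (rs.length : WithBot ℕ∞) ≤ ringKrullDim (R ⧸ p) := by
  induction rs with
  | nil =>
    intro M _ _ _ _ p hp
    have := hp.isPrime
    have : Nontrivial (R ⧸ p) := Ideal.Quotient.nontrivial_iff.mpr hp.isPrime.ne_top
    simpa using ringKrullDim_nonneg_of_nontrivial
  | cons y rs ih =>
    intro M _ _ _ hM p hp
    have hy : y ∈ maximalIdeal R := by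
      simpa using fun isu ↦ hM.2 (by simp [Ideal.span_singleton_eq_top.mpr isu])
    obtain ⟨hreg, htail⟩ := (isRegular_cons_iff M _ _).mp hM
    obtain ⟨q, hq, hpq, hyq⟩ := hreg.exists_associatedPrime_quotSMulTop hy hp
    have := hp.isPrime
    -- Associated primes consist of zero divisors, so the regular element `y` separates `p` from
    -- `q`. The strict inclusion pays for the one extra element of the sequence.
    have hyp : y ∉ p := by
      intro hyp
      have : y ∈ ⋃ p ∈ associatedPrimes R M, (p : Set R) := Set.mem_biUnion hp hyp
      rw [biUnion_associatedPrimes_eq_compl_regular] at this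
      exact this hreg
    have hlt : p < q := lt_of_le_of_ne hpq (by rintro rfl; exact hyp hyq)
    have h1 := ih htail hq
    have h2 := ringKrullDim_quotient_add_one_le_of_lt hlt
    refine le_trans ?_ h2
    push_cast [List.length_cons]
    gcongr

/-- If a prime `p` and the elements of `s` generate an ideal primary to the maximal ideal,
then `dim R / p ≤ |s|`. -/
theorem ringKrullDim_quotient_le_length {R : Type*} [CommRing R] [IsNoetherianRing R]
    [IsLocalRing R] {p : Ideal R} [p.IsPrime] (s : List R)
    (h : ∀ q : Ideal R, q.IsPrime → p ≤ q → (∀ a ∈ s, a ∈ q) → q = maximalIdeal R)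
    (hs : ∀ a ∈ s, a ∈ maximalIdeal R) :
    ringKrullDim (R ⧸ p) ≤ (s.length : WithBot ℕ∞) := by
  classical
  have : Nontrivial (R ⧸ p) := Ideal.Quotient.nontrivial_iff.mpr Ideal.IsPrime.ne_top'
  have : IsLocalRing (R ⧸ p) := .of_surjective' (Ideal.Quotient.mk p) Ideal.Quotient.mk_surjective
  set t : Finset (R ⧸ p) := (s.map (Ideal.Quotient.mk p)).toFinset with ht
  have hcomap : (maximalIdeal (R ⧸ p)).comap (Ideal.Quotient.mk p) = maximalIdeal R :=
    IsLocalRing.eq_maximalIdeal (Ideal.comap_isMaximal_of_surjective _ Ideal.Quotient.mk_surjective)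
  -- This is the hypothesis of Krull's height theorem: the image of `s` in `R ⧸ p` lies in no prime
  -- other than the maximal ideal.
  have hmin : maximalIdeal (R ⧸ p) ∈ (Ideal.span (t : Set (R ⧸ p))).minimalPrimes := by
    refine ⟨⟨inferInstance, ?_⟩, ?_⟩
    · rw [Ideal.span_le]
      intro a ha
      simp only [ht, List.coe_toFinset, List.mem_map, Set.mem_ofPred_eq] at ha
      obtain ⟨b, hb, rfl⟩ := ha
      change b ∈ (maximalIdeal (R ⧸ p)).comap (Ideal.Quotient.mk p)
      rw [hcomap]
      exact hs b hb
    · rintro Q ⟨hQ, hQt⟩ -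
      have := h (Q.comap (Ideal.Quotient.mk p)) (Ideal.comap_isPrime _ _)
        (fun a ha => by
          rw [Ideal.mem_comap, Ideal.Quotient.eq_zero_iff_mem.mpr ha]; exact Q.zero_mem)
        (fun a ha => by
          refine hQt (Ideal.subset_span ?_)
          simp only [ht, List.coe_toFinset, List.mem_map, Set.mem_ofPred_eq]
          exact ⟨a, ha, rfl⟩)
      rw [← hcomap] at this
      exact (Ideal.comap_injective_of_surjective _ Ideal.Quotient.mk_surjective this).ge
  rw [← maximalIdeal_height_eq_ringKrullDim]
  have h1 := Ideal.height_le_card_of_mem_minimalPrimes_span_finset hmin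
  have h2 : t.card ≤ s.length := (List.toFinset_card_le _).trans (by simp)
  have h3 : (maximalIdeal (R ⧸ p)).height ≤ (s.length : ℕ∞) := h1.trans (by exact_mod_cast h2)
  exact_mod_cast h3

open CategoryTheory Abelian in
/-- If `M` has a regular sequence of length `n + 1` and `a` is `M`-regular, then `M / aM` has a
regular sequence of length `n`. -/
theorem IsSMulRegular.exists_isRegular_quotSMulTop {R : Type u} [CommRing R] [IsNoetherianRing R]
    [IsLocalRing R] {M : Type u} [AddCommGroup M] [Module R M] [Module.Finite R M] [Nontrivial M]
    {a : R} (ha : a ∈ maximalIdeal R) (hreg : IsSMulRegular M a) {n : ℕ}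
    (h : ∃ rs : List R, rs.length = n + 1 ∧ (∀ r ∈ rs, r ∈ maximalIdeal R) ∧ IsRegular M rs) :
    ∃ rs : List R, rs.length = n ∧ (∀ r ∈ rs, r ∈ maximalIdeal R) ∧
      IsRegular (QuotSMulTop a M) rs := by
  have hlt : ∀ (N : Type u) [AddCommGroup N] [Module R N] [Module.Finite R N] [Nontrivial N],
      maximalIdeal R • (⊤ : Submodule R N) < ⊤ := fun N _ _ _ _ =>
    (Submodule.top_ne_ideal_smul_of_le_jacobson_annihilator
      (maximalIdeal_le_jacobson _)).symm.lt_top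
  have : Nontrivial (QuotSMulTop a M) := nontrivial_quotSMulTop_of_mem_maximalIdeal M ha
  -- Rees' criterion turns the existence of regular sequences into vanishing of `Ext`. In the long
  -- exact sequence of `0 → M → M → M / aM → 0`, the `i`-th `Ext` into `M / aM` sits between the
  -- `i`-th and the `(i + 1)`-st into `M`, which both vanish for `i < n`.
  have hext := ((ModuleCat.exists_isRegular_tfae (maximalIdeal R) (n + 1) (ModuleCat.of R M)
    (hlt M)).out 3 1).mp h
  refine ((ModuleCat.exists_isRegular_tfae (maximalIdeal R) n
    (ModuleCat.of R (QuotSMulTop a M)) (hlt (QuotSMulTop a M))).out 1 3).mp ?_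
  intro i hi
  have zero1 := AddCommGrpCat.isZero_of_iff_subsingleton.mpr (hext i (by omega))
  have zero2 := AddCommGrpCat.isZero_of_iff_subsingleton.mpr (hext (i + 1) (by omega))
  have hreg' : IsSMulRegular (ModuleCat.of R M) a := hreg
  exact AddCommGrpCat.subsingleton_of_isZero <| ShortComplex.Exact.isZero_of_both_zeros
    ((Ext.covariant_sequence_exact₃' _ hreg'.smulShortComplex_shortExact) i (i + 1) rfl)
    (zero1.eq_zero_of_src _) (zero2.eq_zero_of_tgt _)

/-- If `M` has a regular sequence of the same length as `s`, and `s` generates an ideal primary to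
the maximal ideal modulo the annihilator of `M`, then `s` is a weakly regular sequence on `M`. -/
theorem RingTheory.Sequence.isWeaklyRegular_of_exists_isRegular {R : Type u} [CommRing R]
    [IsNoetherianRing R] [IsLocalRing R] (s : List R) : ∀ {M : Type u} [AddCommGroup M]
    [Module R M] [Module.Finite R M] [Nontrivial M], (∀ a ∈ s, a ∈ maximalIdeal R) →
    (∀ q : Ideal R, q.IsPrime → Module.annihilator R M ≤ q → (∀ a ∈ s, a ∈ q) →
      q = maximalIdeal R) →
    (∃ rs : List R, rs.length = s.length ∧ (∀ r ∈ rs, r ∈ maximalIdeal R) ∧ IsRegular M rs) →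
    IsWeaklyRegular M s := by
  induction s with
  | nil => intros; exact .nil _ _
  | cons a s ih =>
    intro M _ _ _ _ hs hprim hrs
    simp only [List.mem_cons, forall_eq_or_imp] at hs hprim
    have hreg : IsSMulRegular M a := by
      -- A zero divisor `a` lies in an associated prime `p`. The regular sequence gives `dim R / p ≥
      -- |s| + 1`, while modulo `p` the elements of `s` alone already cut out the maximal ideal, so
      -- `dim R / p ≤ |s|`.
      by_contra hcon
      have hmem : a ∈ ⋃ p ∈ associatedPrimes R M, (p : Set R) := by
        rw [biUnion_associatedPrimes_eq_compl_regular]; exact hcon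
      simp only [Set.mem_iUnion] at hmem
      obtain ⟨p, hp, hap⟩ := hmem
      have hp' : IsAssociatedPrime p M := hp
      have := hp'.isPrime
      obtain ⟨rs, hlen, -, hrs⟩ := hrs
      have h1 := hrs.length_le_ringKrullDim_quotient rs hp'
      have h2 := ringKrullDim_quotient_le_length (p := p) s
        (fun q hq hpq hsq => hprim q hq
          ((Submodule.annihilator_top (R := R) (M := M) ▸ hp'.annihilator_le).trans hpq) ⟨hpq hap, hsq⟩) hs.2
      have h3 := h1.trans h2
      rw [hlen] at h3
      have : (a :: s).length ≤ s.length := by exact_mod_cast h3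
      simp at this
    have : Nontrivial (QuotSMulTop a M) := nontrivial_quotSMulTop_of_mem_maximalIdeal M hs.1
    refine IsWeaklyRegular.cons hreg (ih hs.2 (fun q hq hann hsq => ?_)
      (hreg.exists_isRegular_quotSMulTop hs.1 hrs))
    -- The annihilator of `M / aM` contains both `a` and the annihilator of `M`.
    refine hprim q hq (fun r hr => hann ?_) ⟨hann ?_, hsq⟩
    · rw [Module.mem_annihilator] at hr ⊢
      intro m
      obtain ⟨m, rfl⟩ := Submodule.Quotient.mk_surjective _ m
      rw [← Submodule.Quotient.mk_smul, hr, Submodule.Quotient.mk_zero]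
    · rw [Module.mem_annihilator]
      intro m
      obtain ⟨m, rfl⟩ := Submodule.Quotient.mk_surjective _ m
      rw [← Submodule.Quotient.mk_smul, Submodule.Quotient.mk_eq_zero]
      exact Submodule.smul_mem_pointwise_smul _ _ _ trivial

/-- In a Cohen-Macaulay local ring, `dim R` elements generating an ideal whose radical is the
maximal ideal form a regular sequence: each is a non-zero-divisor modulo the previous ones. -/
theorem IsCohenMacaulayLocalRing.mem_of_mul_mem {R : Type u} [CommRing R] [IsLocalRing R]
    (hR : IsCohenMacaulayLocalRing R) {d : ℕ} (hdim : ringKrullDim R = (d : WithBot ℕ∞))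
    (x : Fin d → R) (hrad : (Ideal.span (Set.range x)).radical = maximalIdeal R) (i : Fin d)
    {r : R} (hr : x i * r ∈ Ideal.span (x '' {j | j < i})) :
    r ∈ Ideal.span (x '' {j | j < i}) := by
  have := hR.isNoetherianRing
  have hx : ∀ j, x j ∈ maximalIdeal R := fun j =>
    hrad ▸ Ideal.le_radical (Ideal.subset_span ⟨j, rfl⟩)
  have hreg : IsWeaklyRegular R (List.ofFn x) := by
    refine isWeaklyRegular_of_exists_isRegular _ ?_ ?_ ?_
    · intro a ha
      obtain ⟨j, rfl⟩ := (List.mem_ofFn' _ _).mp ha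
      exact hx j
    · intro q hq _ hxq
      refine le_antisymm (le_maximalIdeal hq.ne_top) ?_
      rw [← hrad, hq.radical_le_iff, Ideal.span_le]
      rintro _ ⟨j, rfl⟩
      exact hxq _ ((List.mem_ofFn' _ _).mpr ⟨j, rfl⟩)
    · obtain ⟨rs, hrs, hlen⟩ := hR.exists_isRegular
      refine ⟨rs, ?_, fun r hr => ?_, hrs⟩
      · rw [hdim] at hlen
        rw [List.length_ofFn]
        exact_mod_cast hlen
      · refine le_maximalIdeal ?_ (Ideal.subset_span (s := {r | r ∈ rs}) (by simpa using hr))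
        intro h
        exact hrs.2 (by rw [Ideal.ofList, h]; simp)
  have hi : (i : ℕ) < (List.ofFn x).length := by simp
  have h := hreg.regular_mod_prev i hi
  have hofList : Ideal.ofList (List.take i (List.ofFn x)) • (⊤ : Submodule R R) =
      Ideal.span (x '' {j | j < i}) := by
    rw [smul_eq_mul, Ideal.mul_top, Ideal.ofList]
    congr 1
    ext a
    simp only [Set.mem_ofPred_eq, Set.mem_image, List.mem_take_iff_getElem, List.getElem_ofFn,
      List.length_ofFn]
    constructor
    · rintro ⟨j, hj, rfl⟩
      exact ⟨⟨j, by omega⟩, Fin.lt_def.mpr (by simp; omega), rfl⟩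
    · rintro ⟨j, hj, rfl⟩
      exact ⟨j, by have := Fin.lt_def.mp hj; omega, rfl⟩
  rw [← hofList] at hr ⊢
  refine mem_of_isSMulRegular_quotient_of_smul_mem h ?_
  simpa using hr

end

/-! ### Syzygies of a regular sequence. -/

/-- If each `x i` is a non-zero-divisor modulo the previous elements, then every syzygy of `x` is
a combination of Koszul syzygies; here for syzygies supported on the first `k` indices. -/
theorem exists_alternating_of_sum_mul_eq_zero_of_lt {R : Type*} [CommRing R] {d : ℕ} (x : Fin d → R)
    (hx : ∀ i r, x i * r ∈ Ideal.span (x '' {j | j < i}) → r ∈ Ideal.span (x '' {j | j < i}))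
    (k : ℕ) (f : Fin d → R) (hsupp : ∀ j : Fin d, k ≤ j → f j = 0) (hf : ∑ j, x j * f j = 0) :
    ∃ a : Fin d → Fin d → R, (∀ i j, a i j = -a j i) ∧ (∀ i, a i i = 0) ∧
      (∀ i j : Fin d, k ≤ i → a i j = 0) ∧ ∀ t, f t = ∑ j, a t j * x j := by
  classical
  induction k generalizing f with
  | zero => exact ⟨fun _ _ => 0, by simp, by simp, by simp, fun t => by simp [hsupp t (by omega)]⟩
  | succ k ih =>
    by_cases hk : k < d
    swap
    · obtain ⟨a, h1, h2, h3, h4⟩ := ih f (fun j hj => absurd j.2 (by omega)) hf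
      exact ⟨a, h1, h2, fun i j hi => h3 i j (by omega), h4⟩
    set κ : Fin d := ⟨k, hk⟩ with hκ
    have hmem : f κ ∈ Ideal.span (x '' {j | j < κ}) := by
      apply hx
      have : x κ * f κ = -∑ j ∈ Finset.univ.erase κ, x j * f j := by
        rw [eq_neg_iff_add_eq_zero, Finset.add_sum_erase _ (fun j => x j * f j) (Finset.mem_univ κ), hf]
      rw [this]
      refine neg_mem (sum_mem fun j hj => ?_)
      have hne : j ≠ κ := Finset.ne_of_mem_erase hj
      by_cases hlt : j < κ
      · exact Ideal.mul_mem_right _ _ (Ideal.subset_span ⟨j, hlt, rfl⟩)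
      · have : k + 1 ≤ (j : ℕ) := by
          have h1 : (j : ℕ) ≠ k := fun h => hne (Fin.ext h)
          have h2 : ¬ (j : ℕ) < k := hlt
          omega
        rw [hsupp j this, mul_zero]
        exact zero_mem _
    obtain ⟨c, hcsupp, hc⟩ : ∃ c : Fin d → R, (∀ j : Fin d, k ≤ j → c j = 0) ∧
        f κ = ∑ j, c j * x j := by
      obtain ⟨c, hcs, hc⟩ := (Finsupp.mem_span_image_iff_linearCombination R).mp hmem
      refine ⟨c, fun j hj => ?_, ?_⟩
      · by_contra h
        have : j < κ := (Finsupp.mem_supported R c).mp hcs (Finsupp.mem_support_iff.mpr h)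
        exact absurd (Fin.lt_def.mp this) (by simp [hκ]; omega)
      · rw [← hc, Finsupp.linearCombination_apply, Finsupp.sum_fintype _ _ (by simp)]
        simp
    -- Adding the Koszul syzygies between `κ` and the earlier indices, weighted by `c`, removes the
    -- coordinate at `κ` and leaves a syzygy supported on the first `k` indices.
    have hsum : ∑ j, x j * (if j = κ then 0 else f j + x κ * c j) = 0 := by
      have h1 : ∑ j, x j * (if j = κ then 0 else f j + x κ * c j) =
          ∑ j, (x j * f j + x κ * (c j * x j) - if j = κ then x κ * f κ else 0) := by
        refine Finset.sum_congr rfl fun j _ => ?_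
        by_cases hj : j = κ
        · simp [hj, hcsupp κ le_rfl]
        · rw [if_neg hj, if_neg hj]; ring
      rw [h1, Finset.sum_sub_distrib, Finset.sum_add_distrib, hf, ← Finset.mul_sum, ← hc]
      simp
    obtain ⟨a, h1, h2, h3, h4⟩ := ih (fun j => if j = κ then 0 else f j + x κ * c j)
      (fun j hj => by
        by_cases hjκ : j = κ
        · simp [hjκ]
        · have : (j : ℕ) ≠ k := fun h => hjκ (Fin.ext h)
          simp [hjκ, hsupp j (by omega), hcsupp j hj]) hsum
    have hcκ : c κ = 0 := hcsupp κ le_rfl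
    -- The matrix for the shorter syzygy is completed by `c` in row `κ` and `-c` in column `κ`,
    -- which undoes the correction.
    refine ⟨fun i j => a i j + (if i = κ then c j else 0) - (if j = κ then c i else 0),
      fun i j => ?_, fun i => ?_, fun i j hi => ?_, fun t => ?_⟩
    · simp only [h1 i j]; ring
    · simp only [h2]; ring
    · have hne : i ≠ κ := fun h => by rw [h] at hi; simp [hκ] at hi
      simp [h3 i j (by omega), hne, hcsupp i (by omega)]
    · have h5 := h4 t
      simp only [sub_mul, add_mul, Finset.sum_sub_distrib, Finset.sum_add_distrib, ← h5]
      by_cases ht : t = κ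
      · simp [ht, hcκ, hc]
      · simp [ht, ite_mul]; ring

/-- If each `x i` is a non-zero-divisor modulo the previous elements, then every syzygy of `x` is
a combination of Koszul syzygies. -/
theorem exists_alternating_of_sum_mul_eq_zero {R : Type*} [CommRing R] {d : ℕ} (x : Fin d → R)
    (hx : ∀ i r, x i * r ∈ Ideal.span (x '' {j | j < i}) → r ∈ Ideal.span (x '' {j | j < i}))
    (f : Fin d → R) (hf : ∑ j, x j * f j = 0) :
    ∃ a : Fin d → Fin d → R, (∀ i j, a i j = -a j i) ∧ (∀ i, a i i = 0) ∧
      ∀ t, f t = ∑ j, a t j * x j := by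
  obtain ⟨a, h1, h2, -, h4⟩ := exists_alternating_of_sum_mul_eq_zero_of_lt x hx d f
    (fun j hj => absurd j.2 (by omega)) hf
  exact ⟨a, h1, h2, h4⟩

/-! ### Lengths of homology modules and Euler characteristics. -/

section

open CategoryTheory

namespace Module

variable {R M N : Type*} [Ring R] [AddCommGroup M] [Module R M] [AddCommGroup N] [Module R N]

theorem length_range_add_length_ker (f : M →ₗ[R] N) :
    Module.length R (LinearMap.range f) + Module.length R (LinearMap.ker f) =
      Module.length R M := by
  rw [Module.length_eq_add_of_exact (LinearMap.ker f).subtype f.rangeRestrict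
    (Submodule.injective_subtype _) f.surjective_rangeRestrict, add_comm]
  rw [LinearMap.exact_iff, LinearMap.ker_rangeRestrict, Submodule.range_subtype]

theorem length_quotient_add_length (P : Submodule R M) :
    Module.length R (M ⧸ P) + Module.length R P = Module.length R M := by
  rw [Module.length_eq_add_of_exact P.subtype P.mkQ (Submodule.injective_subtype _)
    P.mkQ_surjective (LinearMap.exact_subtype_mkQ P), add_comm]

end Module

section Homology

variable {R : Type u} [Ring R]

/-- Homology is cycles modulo boundaries. The additive form avoids subtraction in `ℕ∞`, so no
finiteness is needed. -/
theorem CategoryTheory.ShortComplex.length_homology_add_length_range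
    (S : ShortComplex (ModuleCat.{u} R)) :
    Module.length R S.homology + Module.length R (LinearMap.range S.f.hom) =
      Module.length R (LinearMap.ker S.g.hom) := by
  have e1 : S.homology ≃ₗ[R] (LinearMap.ker S.g.hom ⧸ LinearMap.range S.moduleCatToCycles) :=
    S.moduleCatHomologyIso.toLinearEquiv
  rw [e1.length_eq, ← Module.length_quotient_add_length (LinearMap.range S.moduleCatToCycles)]
  congr 1
  have h : LinearMap.range S.f.hom =
      (LinearMap.range S.moduleCatToCycles).map (LinearMap.ker S.g.hom).subtype := by
    rw [← LinearMap.range_comp]; rfl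
  rw [h]
  exact (Submodule.equivSubtypeMap _ _).symm.length_eq

namespace ChainComplex

variable (K : ChainComplex (ModuleCat.{u} R) ℕ)

theorem length_homology_succ_add_length_range (i : ℕ) :
    Module.length R (K.homology (i + 1)) +
        Module.length R (LinearMap.range (K.d (i + 1 + 1) (i + 1)).hom)
      = Module.length R (LinearMap.ker (K.d (i + 1) i).hom) := by
  have e : K.homology (i + 1) ≃ₗ[R] (K.sc' (i + 2) (i + 1) i).homology :=
    (ShortComplex.homologyMapIso (K.isoSc' (i + 2) (i + 1) i (by simp) (by simp))).toLinearEquiv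
  rw [e.length_eq]
  exact (K.sc' (i + 2) (i + 1) i).length_homology_add_length_range

theorem length_homology_zero_add_length_range :
    Module.length R (K.homology 0) + Module.length R (LinearMap.range (K.d 1 0).hom)
      = Module.length R (K.X 0) := by
  have e : K.homology 0 ≃ₗ[R] (K.sc' 1 0 0).homology :=
    (ShortComplex.homologyMapIso (K.isoSc' 1 0 0 (by simp) (by simp))).toLinearEquiv
  have hg : LinearMap.ker (K.sc' 1 0 0).g.hom = ⊤ := by
    have : (K.sc' 1 0 0).g = 0 := K.shape 0 0 (by simp)
    rw [this]
    exact LinearMap.ker_zero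
  have h := (K.sc' 1 0 0).length_homology_add_length_range
  rw [hg, Module.length_top] at h
  rw [e.length_eq]
  exact h

variable {K}

theorem length_homology_ne_top (hK : ∀ i, Module.length R (K.X i) ≠ ⊤) (i : ℕ) :
    Module.length R (K.homology i) ≠ ⊤ := by
  cases i with
  | zero =>
    have h := K.length_homology_zero_add_length_range
    exact ne_top_of_le_ne_top (hK 0) (h ▸ le_self_add)
  | succ i =>
    have h := K.length_homology_succ_add_length_range i
    have h' := Module.length_range_add_length_ker (K.d (i + 1) i).hom
    exact ne_top_of_le_ne_top (hK (i + 1)) (h' ▸ (h ▸ le_self_add).trans le_add_self)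

/-- The Euler characteristic of a bounded complex of modules of finite length is that of its
homology. -/
theorem sum_length_eq_sum_length_homology (hK : ∀ i, Module.length R (K.X i) ≠ ⊤) (d : ℕ)
    (hd : Subsingleton (K.X (d + 1))) :
    ∑ i ∈ Finset.range (d + 1), (-1 : ℚ) ^ i * ((Module.length R (K.X i)).toNat : ℚ) =
      ∑ i ∈ Finset.range (d + 1), (-1 : ℚ) ^ i * ((Module.length R (K.homology i)).toNat : ℚ) := by
  have hr : ∀ i, Module.length R (LinearMap.range (K.d (i + 1) i).hom) ≠ ⊤ := fun i =>
    ne_top_of_le_ne_top (hK (i + 1))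
      (Module.length_range_add_length_ker (K.d (i + 1) i).hom ▸ le_self_add)
  have hH := length_homology_ne_top hK
  -- The truncated Euler characteristics differ only by the length of the image entering degree `m`.
  -- This error telescopes, and it vanishes at `m = d` since the term in degree `d + 1` is zero.
  have key : ∀ m, ∑ i ∈ Finset.range (m + 1), (-1 : ℚ) ^ i * ((Module.length R (K.X i)).toNat : ℚ) =
      ∑ i ∈ Finset.range (m + 1), (-1 : ℚ) ^ i * ((Module.length R (K.homology i)).toNat : ℚ) +
        (-1) ^ m * ((Module.length R (LinearMap.range (K.d (m + 1) m).hom)).toNat : ℚ) := by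
    intro m
    induction m with
    | zero =>
      simp only [zero_add, Finset.range_one, Finset.sum_singleton, pow_zero, one_mul]
      rw [← K.length_homology_zero_add_length_range, ENat.toNat_add (hH 0) (hr 0)]
      push_cast; rfl
    | succ m ih =>
      have h1 := Module.length_range_add_length_ker (K.d (m + 1) m).hom
      rw [← K.length_homology_succ_add_length_range m] at h1
      have h2 := congrArg ENat.toNat h1
      have h3 : Module.length R (K.homology (m + 1)) +
          Module.length R (LinearMap.range (K.d (m + 1 + 1) (m + 1)).hom) ≠ ⊤ :=
        WithTop.add_ne_top.mpr ⟨hH (m + 1), hr (m + 1)⟩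
      rw [ENat.toNat_add (hr m) h3, ENat.toNat_add (hH _) (hr _)] at h2
      rw [Finset.sum_range_succ, ih, Finset.sum_range_succ _ (m + 1), ← h2]
      push_cast
      ring
  have h0 : Module.length R (LinearMap.range (K.d (d + 1) d).hom) = 0 := by
    rw [Module.length_eq_zero_iff]
    exact (K.d (d + 1) d).hom.surjective_rangeRestrict.subsingleton
  rw [key d, h0]
  simp

end ChainComplex

end Homology

end

/-! ### Homology of the filtered Koszul complex in degrees zero and one. -/

section

open CategoryTheory

theorem Submodule.length_quotient_eq_add {R M : Type*} [Ring R] [AddCommGroup M] [Module R M]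
    {P Q : Submodule R M} (h : P ≤ Q) :
    Module.length R (M ⧸ P) = Module.length R (Q ⧸ P.submoduleOf Q) + Module.length R (M ⧸ Q) := by
  refine Module.length_eq_add_of_exact (Submodule.mapQ (P.submoduleOf Q) P Q.subtype le_rfl)
    (Submodule.factor h) ?_ (Submodule.factor_surjective h) ?_
  · refine (injective_iff_map_eq_zero _).mpr fun z hz => ?_
    obtain ⟨z, rfl⟩ := Submodule.Quotient.mk_surjective _ z
    exact (Submodule.Quotient.mk_eq_zero _).mpr ((Submodule.Quotient.mk_eq_zero P).mp hz)
  · intro z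
    obtain ⟨z, rfl⟩ := Submodule.Quotient.mk_surjective _ z
    rw [← Submodule.mkQ_apply, Submodule.factor_mk, Submodule.mkQ_apply,
      Submodule.Quotient.mk_eq_zero]
    constructor
    · exact fun hz => ⟨Submodule.Quotient.mk ⟨z, hz⟩, rfl⟩
    · rintro ⟨w, hw⟩
      obtain ⟨w, rfl⟩ := Submodule.Quotient.mk_surjective _ w
      have hwz : (w : M) - z ∈ P := (Submodule.Quotient.eq P).mp hw
      have := Q.sub_mem w.2 (h hwz)
      rwa [sub_sub_cancel] at this

namespace Ideal

variable {R : Type u} [CommRing R] (I₁ I₂ : Ideal R) {d : ℕ} (x : Fin d → R) (hx : ∀ j, x j ∈ I₂)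
  (n : ℤ)

theorem length_eq_quotLength_add {A B : Ideal R} (h : B ≤ A) :
    Module.length R (R ⧸ B) = quotLength A B + Module.length R (R ⧸ A) :=
  Submodule.length_quotient_eq_add h

/-- Lifting coordinates to a function on all finite subsets, with the irrelevant value `0` off
cardinality `i`, reduces computations with the differential to identities in `R`. -/
theorem exists_koszulTerm_eq_mk {i : ℕ} (f : KoszulTerm I₁ I₂ d n i) :
    ∃ g : Finset (Fin d) → R, f = fun S => Submodule.Quotient.mk (g S.1) := by
  choose g hg using fun S => Submodule.Quotient.mk_surjective _ (f S)
  refine ⟨fun S => if h : S.card = i then g ⟨S, h⟩ else 0, ?_⟩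
  funext S
  beta_reduce
  rw [dif_pos S.2]
  exact (hg S).symm

theorem length_koszulTerm (i : ℕ) :
    Module.length R (KoszulTerm I₁ I₂ d n i) =
      d.choose i * Module.length R (R ⧸ prodFiltration I₁ I₂ (n - i)) := by
  rw [Module.length_pi_of_fintype, Finset.sum_const, Finset.card_univ, Fintype.card_finset_len,
    Fintype.card_fin, nsmul_eq_mul]

/-- The augmentation of the complex `C(x₁, …, x_d, (1, n))` to `R / (I₁ I₂ ^ n + (x))`. -/
def koszulAugmentation : KoszulTerm I₁ I₂ d n 0 →ₗ[R]
    R ⧸ (prodFiltration I₁ I₂ (n - (0 : ℕ)) ⊔ span (Set.range x)) :=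
  (Submodule.factor le_sup_left).comp (LinearMap.proj ⟨∅, rfl⟩)

theorem koszulAugmentation_surjective :
    Function.Surjective (koszulAugmentation I₁ I₂ x n) := by
  intro z
  obtain ⟨z, rfl⟩ := Submodule.Quotient.mk_surjective _ z
  exact ⟨fun _ => Submodule.Quotient.mk z, rfl⟩

/-- Identifies `H_0`: the boundaries in degree zero are the classes of elements of `(x)`. -/
theorem ker_koszulAugmentation :
    LinearMap.ker (koszulAugmentation I₁ I₂ x n) = LinearMap.range (koszulD I₁ I₂ x hx n 0) := by
  ext f
  rw [LinearMap.mem_ker, LinearMap.mem_range]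
  constructor
  · intro hf
    obtain ⟨g, rfl⟩ := exists_koszulTerm_eq_mk I₁ I₂ n f
    have hf' : g ∅ ∈ prodFiltration I₁ I₂ (n - (0 : ℕ)) ⊔ span (Set.range x) :=
      (Submodule.Quotient.mk_eq_zero _).mp hf
    obtain ⟨a, ha, y, hy, hay⟩ := Submodule.mem_sup.mp hf'
    obtain ⟨c, hc⟩ := mem_span_range_iff_exists_fun.mp hy
    -- On a singleton `{j}` the sum is `c j`; summing avoids having to extract the element of `S`.
    refine ⟨fun S => Submodule.Quotient.mk (∑ j ∈ S.1, c j), ?_⟩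
    funext T
    obtain ⟨T, hT⟩ := T
    obtain rfl := Finset.card_eq_zero.mp hT
    rw [koszulD_apply_mk I₁ I₂ x hx n 0 (fun S => ∑ j ∈ S, c j)]
    rw [Submodule.Quotient.eq, ← hay, ← hc]
    simpa [mul_comm] using ha
  · rintro ⟨f, rfl⟩
    obtain ⟨g, rfl⟩ := exists_koszulTerm_eq_mk I₁ I₂ n f
    change Submodule.factor (le_sup_left : prodFiltration I₁ I₂ (n - (0 : ℕ)) ≤
      prodFiltration I₁ I₂ (n - (0 : ℕ)) ⊔ span (Set.range x)) (koszulD I₁ I₂ x hx n 0 _ _) = 0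
    rw [koszulD_apply_mk]
    refine (Submodule.Quotient.mk_eq_zero _).mpr (Submodule.mem_sup_right ?_)
    rw [LinearMap.id_apply]
    refine Submodule.sum_mem _ fun j _ => ?_
    rw [if_neg (by simp)]
    exact mul_mem_left _ _ (mul_mem_right _ _ (subset_span ⟨j, rfl⟩))

/-- The map `(R / I₁ I₂ ^ (n - 1)) ^ d → R / (x) I₁ I₂ ^ (n - 1)` given by `x₁, …, x_d`. -/
def koszulCycleMap : KoszulTerm I₁ I₂ d n 1 →ₗ[R]
    R ⧸ (span (Set.range x) * prodFiltration I₁ I₂ (n - (1 : ℕ))) :=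
  ∑ j : Fin d, (Submodule.mapQ (prodFiltration I₁ I₂ (n - (1 : ℕ)))
    (span (Set.range x) * prodFiltration I₁ I₂ (n - (1 : ℕ))) (LinearMap.mulLeft R (x j))
      (fun _ hy => mul_mem_mul (subset_span ⟨j, rfl⟩) hy)).comp
    (LinearMap.proj ⟨{j}, Finset.card_singleton j⟩)

theorem koszulCycleMap_apply_mk (g : Finset (Fin d) → R) :
    koszulCycleMap I₁ I₂ x n (fun S => Submodule.Quotient.mk (g S.1)) =
      Submodule.Quotient.mk (∑ j, x j * g {j}) := by
  rw [koszulCycleMap, LinearMap.sum_apply, ← Submodule.mkQ_apply, map_sum]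
  rfl

/-- The image is `(x) / (x) I₁ I₂ ^ (n - 1)`, whose length enters the computation of `h_1`. -/
theorem range_koszulCycleMap :
    LinearMap.range (koszulCycleMap I₁ I₂ x n) =
      LinearMap.ker (Submodule.factor
        (Ideal.mul_le_left : span (Set.range x) * prodFiltration I₁ I₂ (n - (1 : ℕ)) ≤
          span (Set.range x))) := by
  ext z
  obtain ⟨z, rfl⟩ := Submodule.Quotient.mk_surjective _ z
  rw [LinearMap.mem_ker, LinearMap.mem_range]
  change _ ↔ Submodule.Quotient.mk z = _
  rw [Submodule.Quotient.mk_eq_zero]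
  constructor
  · rintro ⟨f, hf⟩
    obtain ⟨g, rfl⟩ := exists_koszulTerm_eq_mk I₁ I₂ n f
    rw [koszulCycleMap_apply_mk, Submodule.Quotient.eq] at hf
    have h1 : ∑ j, x j * g {j} ∈ span (Set.range x) :=
      Submodule.sum_mem _ fun j _ => mul_mem_right _ _ (subset_span ⟨j, rfl⟩)
    have := sub_mem h1 (Ideal.mul_le_left hf)
    rwa [sub_sub_cancel] at this
  · intro hz
    obtain ⟨c, hc⟩ := mem_span_range_iff_exists_fun.mp hz
    refine ⟨fun S => Submodule.Quotient.mk (∑ j ∈ S.1, c j), ?_⟩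
    rw [koszulCycleMap_apply_mk I₁ I₂ x n (fun S => ∑ j ∈ S, c j), ← hc]
    simp [mul_comm]

/-- An alternating matrix is encoded as a degree-two chain whose coefficient at a pair is the entry
at (larger, smaller) index. The Koszul sign is `-1` exactly when `t < j`, where antisymmetry swaps
the indices back. -/
theorem koszul_sum_singleton_eq {a : Fin d → Fin d → R} (h1 : ∀ i j, a i j = -a j i)
    (h2 : ∀ i, a i i = 0) (t : Fin d) :
    (∑ j : Fin d, if j ∈ ({t} : Finset (Fin d)) then (0 : R) else
      (-1 : R) ^ (({t} : Finset (Fin d)).filter (fun l => l < j)).card *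
        (x j * (fun S : Finset (Fin d) => if h : S.Nonempty then a (S.max' h) (S.min' h) else 0)
          (insert j {t}))) = ∑ j, a t j * x j := by
  refine Finset.sum_congr rfl fun j _ => ?_
  have hne : (insert j ({t} : Finset (Fin d))).Nonempty := Finset.insert_nonempty _ _
  have hmax : (insert j ({t} : Finset (Fin d))).max' hne = max t j := by
    rw [Finset.max'_insert j {t} (Finset.singleton_nonempty t), Finset.max'_singleton, max_comm]
  have hmin : (insert j ({t} : Finset (Fin d))).min' hne = min t j := by
    rw [Finset.min'_insert j {t} (Finset.singleton_nonempty t), Finset.min'_singleton, min_comm]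
  simp only [dif_pos hne, hmax, hmin, Finset.mem_singleton, Finset.filter_singleton]
  rcases lt_trichotomy t j with h | h | h
  · rw [if_neg h.ne', if_pos h, max_eq_right h.le, min_eq_left h.le, h1 t j]
    simp [mul_comm]
  · simp [h, h2]
  · rw [if_neg h.ne, if_neg h.not_gt, max_eq_left h.le, min_eq_right h.le]
    simp [mul_comm]

/-- If `∑ x_j g_j` lies in `(x) I₁ I₂ ^ (n - 1)`, it equals `∑ x_j b_j` with all `b_j` in `I₁ I₂ ^
(n - 1)`. Then `g - b` is a syzygy of `x`, hence a Koszul boundary by regularity, and `b` vanishes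
in the quotient. Conversely boundaries are killed because consecutive Koszul maps compose to zero.
-/
theorem ker_koszulCycleMap
    (hreg : ∀ i r, x i * r ∈ span (x '' {j | j < i}) → r ∈ span (x '' {j | j < i})) :
    LinearMap.ker (koszulCycleMap I₁ I₂ x n) = LinearMap.range (koszulD I₁ I₂ x hx n 1) := by
  ext f
  rw [LinearMap.mem_ker, LinearMap.mem_range]
  constructor
  · intro hf
    obtain ⟨g, rfl⟩ := exists_koszulTerm_eq_mk I₁ I₂ n f
    rw [koszulCycleMap_apply_mk, Submodule.Quotient.mk_eq_zero, mul_comm, ← smul_eq_mul,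
      Ideal.span, Submodule.mem_ideal_smul_span_iff_exists_sum] at hf
    obtain ⟨b, hb, hsum⟩ := hf
    rw [Finsupp.sum_fintype _ _ (by simp)] at hsum
    obtain ⟨a, h1, h2, h3⟩ := exists_alternating_of_sum_mul_eq_zero x hreg
      (fun j => g {j} - b j) (by
        simp only [mul_sub, Finset.sum_sub_distrib]
        rw [← hsum, sub_eq_zero]
        exact Finset.sum_congr rfl fun j _ => mul_comm _ _)
    refine ⟨fun S => Submodule.Quotient.mk ((fun S : Finset (Fin d) =>
      if h : S.Nonempty then a (S.max' h) (S.min' h) else 0) S.1), ?_⟩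
    funext T
    obtain ⟨T, hT⟩ := T
    obtain ⟨t, rfl⟩ := Finset.card_eq_one.mp hT
    refine (koszulD_apply_mk I₁ I₂ x hx n 1 (fun S : Finset (Fin d) =>
      if h : S.Nonempty then a (S.max' h) (S.min' h) else 0) _).trans ?_
    rw [koszul_sum_singleton_eq x h1 h2 t, ← h3 t, Submodule.Quotient.eq]
    simpa using hb t
  · rintro ⟨f, rfl⟩
    obtain ⟨g, rfl⟩ := exists_koszulTerm_eq_mk I₁ I₂ n f
    have h : koszulD I₁ I₂ x hx n 1 (fun S => Submodule.Quotient.mk (g S.1)) =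
        fun T => Submodule.Quotient.mk ((fun T : Finset (Fin d) =>
          ∑ j : Fin d, if j ∈ T then 0 else
          (-1 : R) ^ (T.filter (fun l => l < j)).card * (x j * g (insert j T))) T.1) :=
      funext fun T => koszulD_apply_mk I₁ I₂ x hx n 1 g T
    rw [h]
    refine (koszulCycleMap_apply_mk I₁ I₂ x n (fun T : Finset (Fin d) =>
      ∑ j : Fin d, if j ∈ T then 0 else
        (-1 : R) ^ (T.filter (fun l => l < j)).card * (x j * g (insert j T)))).trans ?_
    -- At the empty set the identity behind `d ∘ d = 0` says that `∑ x_j (dg)_j = 0` already holds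
    -- in `R`.
    have h0 := koszul_sum_eq_zero x g ∅
    simp only [Finset.notMem_empty, if_false, Finset.filter_empty, Finset.card_empty, pow_zero,
      one_mul, insert_empty_eq] at h0
    rw [h0, Submodule.Quotient.mk_zero]

theorem koszulFiltComplex_d (i : ℕ) :
    ((koszulFiltComplex I₁ I₂ x hx n).d (i + 1) i).hom = koszulD I₁ I₂ x hx n i := by
  exact congrArg ModuleCat.Hom.hom (ChainComplex.of_d
    (fun i => ModuleCat.of R (KoszulTerm I₁ I₂ d n i))
    (fun i => ModuleCat.ofHom (koszulD I₁ I₂ x hx n i)) i)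

variable {I₁ I₂}

theorem length_koszulTerm_ne_top
    (hfin : ∀ m : ℤ, Module.length R (R ⧸ prodFiltration I₁ I₂ m) ≠ ⊤) (i : ℕ) :
    Module.length R (KoszulTerm I₁ I₂ d n i) ≠ ⊤ := by
  rw [length_koszulTerm]
  exact WithTop.mul_ne_top (ENat.natCast_ne_top _) (hfin _)

theorem length_koszulFiltHomology_ne_top
    (hfin : ∀ m : ℤ, Module.length R (R ⧸ prodFiltration I₁ I₂ m) ≠ ⊤) (i : ℕ) :
    Module.length R (koszulFiltHomology I₁ I₂ x hx n i) ≠ ⊤ :=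
  ChainComplex.length_homology_ne_top (length_koszulTerm_ne_top n hfin) i

/-- The alternating sum of the lengths of the homology modules. -/
theorem sum_choose_mul_hilbertFn_eq
    (hfin : ∀ m : ℤ, Module.length R (R ⧸ prodFiltration I₁ I₂ m) ≠ ⊤) :
    ∑ i ∈ Finset.range (d + 1), (-1 : ℚ) ^ i * (d.choose i * hilbertFn I₁ I₂ (n - i) : ℚ) =
      ∑ i ∈ Finset.range (d + 1), (-1 : ℚ) ^ i * (koszulFiltLength I₁ I₂ x hx n i : ℚ) := by
  have hsub : Subsingleton (KoszulTerm I₁ I₂ d n (d + 1)) := by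
    rw [← Module.length_eq_zero_iff (R := R), length_koszulTerm]
    simp
  have h := ChainComplex.sum_length_eq_sum_length_homology
    (K := koszulFiltComplex I₁ I₂ x hx n) (length_koszulTerm_ne_top n hfin) d hsub
  refine Eq.trans (Finset.sum_congr rfl fun i _ => ?_) h
  have h' : Module.length R ((koszulFiltComplex I₁ I₂ x hx n).X i) = _ :=
    length_koszulTerm I₁ I₂ n i
  rw [h', ENat.toNat_mul, ENat.toNat_natCast, hilbertFn]
  push_cast
  rfl

/-- The length of the zeroth homology module. -/
theorem length_koszulFiltHomology_zero
    (hfin : ∀ m : ℤ, Module.length R (R ⧸ prodFiltration I₁ I₂ m) ≠ ⊤) :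
    Module.length R (koszulFiltHomology I₁ I₂ x hx n 0) =
      Module.length R (R ⧸ (prodFiltration I₁ I₂ n ⊔ span (Set.range x))) := by
  have h0 := (koszulFiltComplex I₁ I₂ x hx n).length_homology_zero_add_length_range
  rw [koszulFiltComplex_d] at h0
  have h1 := Module.length_range_add_length_ker (koszulAugmentation I₁ I₂ x n)
  rw [ker_koszulAugmentation I₁ I₂ x hx,
    LinearMap.range_eq_top.mpr (koszulAugmentation_surjective I₁ I₂ x n), Module.length_top] at h1
  have hr : Module.length R (LinearMap.range (koszulD I₁ I₂ x hx n 0)) ≠ ⊤ :=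
    ne_top_of_le_ne_top (length_koszulTerm_ne_top (d := d) n hfin 0) (h1 ▸ le_add_self)
  have h2 := ENat.add_left_injective_of_ne_top hr (h0.trans h1.symm)
  have hn : n - ((0 : ℕ) : ℤ) = n := by simp
  rwa [hn] at h2

/-- The bookkeeping for `h_1`: `h₁ = z - r₁ = b - r₀ = (q - p) - (a - e) = u - v`. Finiteness of
`a`, `c` and `q` forces that of all the other quantities, so the computation may be done in `ℕ`. -/
theorem koszul_length_relation {h₀ r₀ a h₁ r₁ z c b p q u e v : ℕ∞} (ha : a ≠ ⊤) (hc : c ≠ ⊤)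
    (hq : q ≠ ⊤) (eq1 : h₀ + r₀ = a) (eq2 : h₁ + r₁ = z) (eq3 : r₀ + z = c) (eq4 : b + r₁ = c)
    (eq5 : p + b = q) (eq6 : q = u + a) (eq7 : p = v + e) (eq8 : h₀ = e) :
    v.toNat + h₁.toNat = u.toNat := by
  subst eq8 eq7 eq2
  lift a to ℕ using ha
  lift c to ℕ using hc
  lift q to ℕ using hq
  have hh₀ : h₀ ≠ ⊤ := by rintro rfl; simp at eq1
  have hr₀ : r₀ ≠ ⊤ := by rintro rfl; simp at eq1
  have hh₁ : h₁ ≠ ⊤ := by rintro rfl; simp at eq3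
  have hr₁ : r₁ ≠ ⊤ := by rintro rfl; simp at eq3
  have hb : b ≠ ⊤ := by rintro rfl; simp at eq4
  have hv : v ≠ ⊤ := by rintro rfl; simp at eq5
  have hu : u ≠ ⊤ := by rintro rfl; simp at eq6
  lift h₀ to ℕ using hh₀
  lift r₀ to ℕ using hr₀
  lift h₁ to ℕ using hh₁
  lift r₁ to ℕ using hr₁
  lift b to ℕ using hb
  lift v to ℕ using hv
  lift u to ℕ using hu
  norm_cast at *
  simp only [ENat.toNat_natCast]
  omega

/-- The first homology module is `((x) ∩ I₁ I₂ ^ n) / (x) I₁ I₂ ^ (n - 1)`, so that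
`ℓ((I₁ I₂ ^ n + (x)) / (x)) + h₁ = ℓ(I₁ I₂ ^ n / (x) I₁ I₂ ^ (n - 1))`. -/
theorem quotLength_add_koszulFiltLength_one
    (hreg : ∀ i r, x i * r ∈ span (x '' {j | j < i}) → r ∈ span (x '' {j | j < i}))
    (hfin : ∀ m : ℤ, Module.length R (R ⧸ prodFiltration I₁ I₂ m) ≠ ⊤)
    (hfin' : Module.length R (R ⧸ span (Set.range x) * prodFiltration I₁ I₂ (n - 1)) ≠ ⊤)
    (hle : span (Set.range x) * prodFiltration I₁ I₂ (n - 1) ≤ prodFiltration I₁ I₂ n) :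
    (quotLength (prodFiltration I₁ I₂ n ⊔ span (Set.range x)) (span (Set.range x))).toNat +
        koszulFiltLength I₁ I₂ x hx n 1 =
      (quotLength (prodFiltration I₁ I₂ n)
        (span (Set.range x) * prodFiltration I₁ I₂ (n - 1))).toNat := by
  have h0 := (koszulFiltComplex I₁ I₂ x hx n).length_homology_zero_add_length_range
  have h1 := (koszulFiltComplex I₁ I₂ x hx n).length_homology_succ_add_length_range 0
  rw [koszulFiltComplex_d] at h0 h1
  rw [koszulFiltComplex_d] at h1
  have h3 := Module.length_range_add_length_ker (koszulCycleMap I₁ I₂ x n)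
  rw [ker_koszulCycleMap I₁ I₂ x hx n hreg, range_koszulCycleMap] at h3
  have h4 := Module.length_range_add_length_ker (Submodule.factor
        (Ideal.mul_le_left : span (Set.range x) * prodFiltration I₁ I₂ (n - (1 : ℕ)) ≤
          span (Set.range x)))
  rw [LinearMap.range_eq_top.mpr (Submodule.factor_surjective _), Module.length_top] at h4
  have h7 : Module.length R ((koszulFiltComplex I₁ I₂ x hx n).X 0) = _ :=
    length_koszulTerm I₁ I₂ n 0
  have hn : n - ((0 : ℕ) : ℤ) = n := by simp
  rw [Nat.choose_zero_right, Nat.cast_one, one_mul, hn] at h7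
  exact koszul_length_relation (hfin n) (length_koszulTerm_ne_top n hfin 1) hfin' (h0.trans h7) h1
    (Module.length_range_add_length_ker (koszulD I₁ I₂ x hx n 0)) h3 h4
    (length_eq_quotLength_add hle) (length_eq_quotLength_add le_sup_right)
    (length_koszulFiltHomology_zero x hx n hfin)

end Ideal

end

/-! ### Iterated differences and eventually polynomial functions. -/

section

open Filter

section Difference

/-- Pascal's rule. The coefficients are the signed numbers of summands in the Koszul terms, which is
why `Δ^d` of the Hilbert function is an Euler characteristic. -/
theorem backwardDiff_iterate_eq_sum (d : ℕ) (f : ℤ → ℚ) (n : ℤ) :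
    backwardDiff^[d] f n =
      ∑ i ∈ Finset.range (d + 1), (-1 : ℚ) ^ i * (d.choose i * f (n - i)) := by
  induction d generalizing f n with
  | zero => simp
  | succ d ih =>
    rw [Function.iterate_succ_apply, ih]
    have h1 := Finset.sum_range_succ' 
      (fun i : ℕ => (-1 : ℚ) ^ i * ((d + 1).choose i * f (n - i))) (d + 1)
    rw [h1]
    have h2 : ∀ i : ℕ, (-1 : ℚ) ^ (i + 1) * (((d + 1).choose (i + 1) : ℕ) * f (n - ((i + 1 : ℕ) : ℤ))) =
        (-1 : ℚ) ^ (i + 1) * (d.choose (i + 1) * f (n - ((i + 1 : ℕ) : ℤ))) -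
          (-1 : ℚ) ^ i * (d.choose i * f (n - i - 1)) := by
      intro i
      rw [Nat.choose_succ_succ]
      push_cast
      rw [sub_add_eq_sub_sub]
      ring
    have h3 := Finset.sum_range_succ' (fun i : ℕ => (-1 : ℚ) ^ i * (d.choose i * f (n - i))) (d + 1)
    rw [Finset.sum_range_succ, Nat.choose_succ_self, Nat.cast_zero, zero_mul, mul_zero,
      add_zero] at h3
    rw [Finset.sum_congr rfl fun i _ => h2 i, Finset.sum_sub_distrib]
    simp only [backwardDiff, mul_sub, Finset.sum_sub_distrib]
    simp only [Nat.choose_zero_right] at h3 ⊢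
    linarith

theorem backwardDiff_iterate_sub (d : ℕ) (f g : ℤ → ℚ) (n : ℤ) :
    backwardDiff^[d] (fun m => f m - g m) n = backwardDiff^[d] f n - backwardDiff^[d] g n := by
  simp only [backwardDiff_iterate_eq_sum, mul_sub, Finset.sum_sub_distrib]

theorem Filter.Eventually.sub_const_int {p : ℤ → Prop} (h : ∀ᶠ n in atTop, p n) (k : ℤ) :
    ∀ᶠ n in atTop, p (n - k) :=
  (tendsto_atTop_add_const_right atTop (-k) tendsto_id).eventually h

theorem backwardDiff_iterate_eventuallyEq {f g : ℤ → ℚ} (h : f =ᶠ[atTop] g) (d : ℕ) :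
    backwardDiff^[d] f =ᶠ[atTop] backwardDiff^[d] g := by
  have h' : ∀ᶠ n in atTop, ∀ i ∈ Finset.range (d + 1), f (n - (i : ℕ)) = g (n - (i : ℕ)) :=
    (Filter.eventually_all_finset _).mpr fun i _ => Filter.Eventually.sub_const_int h i
  filter_upwards [h'] with n hn
  rw [backwardDiff_iterate_eq_sum, backwardDiff_iterate_eq_sum]
  exact Finset.sum_congr rfl fun i hi => by rw [hn i hi]

namespace Polynomial

theorem exists_eval_sub_eval_sub_one (Q : ℚ[X]) :
    ∃ P : ℚ[X], ∀ t : ℚ, P.eval t - P.eval (t - 1) = Q.eval t := by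
  induction Q using Polynomial.induction_on' with
  | add p q hp hq =>
    obtain ⟨P, hP⟩ := hp
    obtain ⟨Q, hQ⟩ := hq
    exact ⟨P + Q, fun t => by simp only [eval_add, ← hP, ← hQ]; ring⟩
  | monomial k c =>
    -- Bernoulli polynomials satisfy `B_{k+1}(1 + t) - B_{k+1}(t) = (k + 1) t ^ k`; the shift by one
    -- makes this a backward difference.
    refine ⟨C (c / (k + 1)) * (bernoulli (k + 1)).comp (1 + X), fun t => ?_⟩
    have h := bernoulli_eval_one_add (k + 1) t
    simp only [eval_mul, eval_C, eval_comp, eval_add, eval_one, eval_X, eval_monomial, h,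
      add_sub_cancel]
    have : (k : ℚ) + 1 ≠ 0 := by positivity
    push_cast
    field_simp
    ring

theorem eq_of_eventually_eval_intCast_eq {P Q : ℚ[X]}
    (h : ∀ᶠ n : ℤ in atTop, P.eval (n : ℚ) = Q.eval (n : ℚ)) : P = Q := by
  obtain ⟨N, hN⟩ := eventually_atTop.mp h
  refine Polynomial.eq_of_infinite_eval_eq P Q ?_
  refine ((Set.Ici_infinite N).image (f := fun n : ℤ => (n : ℚ)) Int.cast_injective.injOn).mono ?_
  rintro _ ⟨n, hn, rfl⟩
  exact hN n hn

/-- A function on `ℤ` whose `d`-th difference is eventually constant is eventually a polynomial. -/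
theorem exists_eventually_eval_eq (d : ℕ) (f : ℤ → ℚ) (c : ℚ)
    (h : ∀ᶠ n in atTop, backwardDiff^[d] f n = c) :
    ∃ P : ℚ[X], ∀ᶠ n : ℤ in atTop, P.eval (n : ℚ) = f n := by
  induction d generalizing f with
  | zero => exact ⟨C c, by simpa [eq_comm] using h⟩
  | succ d ih =>
    obtain ⟨Q, hQ⟩ := ih (backwardDiff f) h
    obtain ⟨P, hP⟩ := exists_eval_sub_eval_sub_one Q
    obtain ⟨N, hN⟩ := eventually_atTop.mp hQ
    -- The constant makes the polynomial agree with `f` at `N`; equal differences then propagate the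
    -- agreement upwards.
    refine ⟨P + C (f N - P.eval (N : ℚ)), eventually_atTop.mpr ⟨N, fun n hn => ?_⟩⟩
    induction n, hn using Int.leInduction with
    | base => simp
    | succ n hn ihn =>
      have h1 := hN (n + 1) (by omega)
      rw [← hP, backwardDiff] at h1
      push_cast at h1
      rw [add_sub_cancel_right, add_sub_cancel_right] at h1
      simp only [eval_add, eval_C] at ihn ⊢
      push_cast
      linarith

/-- If the `d`-th difference of a polynomial is eventually constant, it is constant. -/
theorem backwardDiff_iterate_eval_eq (d : ℕ) (P : ℚ[X]) (c : ℚ)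
    (h : ∀ᶠ n in atTop, backwardDiff^[d] (fun m : ℤ => P.eval (m : ℚ)) n = c) (n : ℤ) :
    backwardDiff^[d] (fun m : ℤ => P.eval (m : ℚ)) n = c := by
  -- The `d`-th difference of `P` is itself given by a polynomial, so agreeing with `c` at
  -- infinitely many integers makes it constant.
  set Q : ℚ[X] := ∑ i ∈ Finset.range (d + 1),
    C ((-1 : ℚ) ^ i * d.choose i) * P.comp (X - C (i : ℚ)) with hQ
  have hev : ∀ n : ℤ, backwardDiff^[d] (fun m : ℤ => P.eval (m : ℚ)) n = Q.eval (n : ℚ) := by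
    intro n
    rw [backwardDiff_iterate_eq_sum, hQ, eval_finsetSum]
    refine Finset.sum_congr rfl fun i _ => ?_
    simp [mul_assoc]
  have hQc : Q = C c := by
    refine eq_of_eventually_eval_intCast_eq ?_
    filter_upwards [h] with n hn
    rw [← hev, hn, eval_C]
  rw [hev, hQc, eval_C]

end Polynomial

end Difference

end

/-! ### Finiteness and differences of the Hilbert function. -/

section

open Filter

namespace Ideal

variable {R : Type u} [CommRing R]

theorem IsMaximalIdealPrimary.exists_pow_le [IsLocalRing R] [IsNoetherianRing R] {I : Ideal R}
    (hI : I.IsMaximalIdealPrimary) : ∃ k, IsLocalRing.maximalIdeal R ^ k ≤ I := by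
  have h := exists_radical_pow_le_of_fg I (IsNoetherian.noetherian _)
  rwa [hI.2] at h

/-- For proper `I`, the quotient is a Noetherian local ring with nilpotent maximal ideal, hence
Artinian, and its length over `R` equals its length over itself. -/
theorem length_quotient_ne_top_of_pow_le [IsLocalRing R] [IsNoetherianRing R] {I : Ideal R} {k : ℕ}
    (h : IsLocalRing.maximalIdeal R ^ k ≤ I) : Module.length R (R ⧸ I) ≠ ⊤ := by
  rcases eq_or_ne I ⊤ with rfl | hI
  · have : Subsingleton (R ⧸ (⊤ : Ideal R)) := Ideal.Quotient.subsingleton_iff.mpr rfl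
    rw [Module.length_eq_zero]
    exact ENat.zero_ne_top
  have : Nontrivial (R ⧸ I) := Ideal.Quotient.nontrivial_iff.mpr hI
  have : IsLocalRing (R ⧸ I) := .of_surjective' (Ideal.Quotient.mk I) Ideal.Quotient.mk_surjective
  have hart : IsArtinianRing (R ⧸ I) := by
    rw [isArtinianRing_iff_isNilpotent_maximalIdeal]
    refine ⟨k, ?_⟩
    have hmap : IsLocalRing.maximalIdeal (R ⧸ I) =
        (IsLocalRing.maximalIdeal R).map (Ideal.Quotient.mk I) := by
      rw [← map_comap_of_surjective _ Ideal.Quotient.mk_surjective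
        (IsLocalRing.maximalIdeal (R ⧸ I))]
      congr 1
      exact IsLocalRing.eq_maximalIdeal
        (comap_isMaximal_of_surjective _ Ideal.Quotient.mk_surjective)
    rw [hmap, ← Ideal.map_pow, zero_eq_bot, map_eq_bot_iff_le_ker, mk_ker]
    exact h
  rw [Module.length_eq_of_surjective (S := R) (R := R ⧸ I) (M := R ⧸ I)
    Ideal.Quotient.mk_surjective]
  exact Module.length_ne_top

theorem exists_pow_le_prodFiltration [IsLocalRing R] [IsNoetherianRing R] {I₁ I₂ : Ideal R}
    (hI₁ : I₁.IsMaximalIdealPrimary) (hI₂ : I₂.IsMaximalIdealPrimary) (n : ℤ) :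
    ∃ k, IsLocalRing.maximalIdeal R ^ k ≤ prodFiltration I₁ I₂ n := by
  obtain ⟨k, hk⟩ := hI₁.exists_pow_le
  obtain ⟨l, hl⟩ := hI₂.exists_pow_le
  refine ⟨k + l * n.toNat, ?_⟩
  rw [pow_add, pow_mul]
  exact mul_mono hk (pow_right_mono hl _)

/-- Multiplication by `y` on `R / J` shifts lengths: if `y` is regular modulo `J`, and `yR ∩ A = yB`
modulo `J`, then `ℓ(R / (J + A)) = ℓ(R / (J + B)) + ℓ(R / (J + yR + A))`. -/
theorem length_quotient_sup_eq_add {J A B : Ideal R} {y : R} (hyB : ∀ b ∈ B, y * b ∈ A)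
    (hreg : ∀ r, y * r ∈ J → r ∈ J)
    (hsup : ∀ r, y * r ∈ J ⊔ A → ∃ b ∈ B, y * r - y * b ∈ J) :
    Module.length R (R ⧸ (J ⊔ A)) =
      Module.length R (R ⧸ (J ⊔ B)) + Module.length R (R ⧸ (J ⊔ span {y} ⊔ A)) := by
  have hle : J ⊔ B ≤ Submodule.comap (LinearMap.mulLeft R y) (J ⊔ A) := by
    refine sup_le (fun r hr => ?_) (fun r hr => ?_)
    · exact mem_sup_left (J.mul_mem_left y hr)
    · exact mem_sup_right (hyB r hr)
  have hle' : J ⊔ A ≤ J ⊔ span {y} ⊔ A := sup_le_sup_right le_sup_left _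
  -- The sequence is `0 → R / (J + B) → R / (J + A) → R / (J + yR + A) → 0`, the first map being
  -- multiplication by `y`. Its injectivity is where `hsup` and `hreg` enter.
  refine Module.length_eq_add_of_exact (Submodule.mapQ (J ⊔ B) (J ⊔ A) (LinearMap.mulLeft R y) hle)
    (Submodule.factor hle') ?_ (Submodule.factor_surjective _) ?_
  · refine (injective_iff_map_eq_zero _).mpr fun z hz => ?_
    obtain ⟨z, rfl⟩ := Submodule.Quotient.mk_surjective _ z
    have hz' : y * z ∈ J ⊔ A := (Submodule.Quotient.mk_eq_zero _).mp hz
    obtain ⟨b, hb, hzb⟩ := hsup z hz'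
    refine (Submodule.Quotient.mk_eq_zero _).mpr ?_
    rw [← mul_sub] at hzb
    have h := add_mem (mem_sup_left (hreg _ hzb) : _ ∈ J ⊔ B) (mem_sup_right hb : _ ∈ J ⊔ B)
    rwa [sub_add_cancel] at h
  · intro z
    obtain ⟨z, rfl⟩ := Submodule.Quotient.mk_surjective _ z
    change Submodule.Quotient.mk z = 0 ↔ _
    rw [Submodule.Quotient.mk_eq_zero]
    constructor
    · intro hz
      obtain ⟨u, hu, a, ha, rfl⟩ := Submodule.mem_sup.mp hz
      obtain ⟨j, hj, w, hw, rfl⟩ := Submodule.mem_sup.mp hu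
      obtain ⟨c, rfl⟩ := mem_span_singleton'.mp hw
      refine ⟨Submodule.Quotient.mk c, (Submodule.Quotient.eq _).mpr ?_⟩
      have h : -(j + a) ∈ J ⊔ A := neg_mem (add_mem (mem_sup_left hj) (mem_sup_right ha))
      convert h using 1
      rw [LinearMap.mulLeft_apply]
      ring
    · rintro ⟨c, hc⟩
      obtain ⟨c, rfl⟩ := Submodule.Quotient.mk_surjective _ c
      have h : y * c - z ∈ J ⊔ A := (Submodule.Quotient.eq _).mp hc
      have h' : y * c ∈ J ⊔ span {y} ⊔ A :=
        mem_sup_left (mem_sup_right (mul_mem_right _ _ (mem_span_singleton_self y)))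
      have := sub_mem h' (hle' h)
      rwa [sub_sub_cancel] at this

/-- The superficial condition modulo `J`, lifted to `R`. -/
theorem IsSuperficial.exists_mul_sub_mul_mem {J I₁ I₂ : Ideal R} {y : R}
    (h : IsSuperficial (Ideal.Quotient.mk J y) (I₂.map (Ideal.Quotient.mk J))
      (I₁.map (Ideal.Quotient.mk J))) :
    ∃ N : ℕ, ∀ r, N ≤ r → ∀ z, y * z ∈ J ⊔ I₁ * I₂ ^ r →
      ∃ b ∈ I₁ * I₂ ^ (r - 1), y * z - y * b ∈ J := by
  obtain ⟨-, N, -, hN⟩ := h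
  refine ⟨N, fun r hr z hz => ?_⟩
  have hmap : ∀ s, I₁.map (Ideal.Quotient.mk J) ^ 1 * I₂.map (Ideal.Quotient.mk J) ^ s =
      (I₁ * I₂ ^ s).map (Ideal.Quotient.mk J) := fun s => by
    rw [pow_one, Ideal.map_mul, Ideal.map_pow]
  -- The exponent of `I₁` in the filtration is `1`, so superficiality is applied with `s = 1`.
  have h1 := hN r hr 1
  rw [hmap, hmap] at h1
  have h2 : Ideal.Quotient.mk J (y * z) ∈ span {Ideal.Quotient.mk J y} ⊓
      (I₁ * I₂ ^ r).map (Ideal.Quotient.mk J) := by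
    refine ⟨?_, ?_⟩
    · rw [map_mul]
      exact mul_mem_right _ _ (mem_span_singleton_self _)
    · obtain ⟨j, hj, a, ha, hja⟩ := Submodule.mem_sup.mp hz
      rw [← hja, map_add, Ideal.Quotient.eq_zero_iff_mem.mpr hj, zero_add]
      exact mem_map_of_mem _ ha
  rw [h1, mem_span_singleton_mul] at h2
  obtain ⟨b, hb, hbz⟩ := h2
  obtain ⟨b, hb', rfl⟩ := (mem_map_iff_of_surjective _ Ideal.Quotient.mk_surjective).mp hb
  refine ⟨b, hb', ?_⟩
  rw [← Ideal.Quotient.eq, ← hbz, map_mul]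

/-- For a superficial sequence that is regular, the `d`-th difference of the Hilbert function is
eventually `ℓ(R / (x))`. -/
theorem eventually_backwardDiff_iterate_hilbertFn_eq {d : ℕ} (x : Fin d → R) {I₁ I₂ : Ideal R}
    (hx : ∀ j, x j ∈ I₂)
    (hreg : ∀ i r, x i * r ∈ span (x '' {j | j < i}) → r ∈ span (x '' {j | j < i}))
    (hsup : IsSuperficialSequence x I₂ I₁)
    (hfin : ∀ m : ℤ, Module.length R (R ⧸ prodFiltration I₁ I₂ m) ≠ ⊤)
    (hpow : ∃ r : ℕ, I₂ ^ r ≤ span (Set.range x)) :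
    ∀ᶠ n in atTop, backwardDiff^[d] (fun m : ℤ => (hilbertFn I₁ I₂ m : ℚ)) n =
      ((Module.length R (R ⧸ span (Set.range x))).toNat : ℚ) := by
  -- `F k` is the Hilbert function after killing the first `k` elements. It interpolates between
  -- `H(1, n)` at `k = 0` and, for large `n`, the constant `ℓ(R / (x))` at `k = d`; each `k` costs
  -- one difference.
  set F : ℕ → ℤ → ℚ := fun k n => ((Module.length R (R ⧸
    (span (x '' {j | (j : ℕ) < k}) ⊔ prodFiltration I₁ I₂ n))).toNat : ℚ) with hF
  have hstep : ∀ k < d, ∀ᶠ n in atTop, backwardDiff (F k) n = F (k + 1) n := by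
    intro k hk
    obtain ⟨N, hN⟩ := (hsup ⟨k, hk⟩).exists_mul_sub_mul_mem
    filter_upwards [eventually_ge_atTop ((N : ℤ) + 1)] with n hn
    have hJ : span (x '' {j | (j : ℕ) < k}) ⊔ span {x ⟨k, hk⟩} =
        span (x '' {j | (j : ℕ) < k + 1}) := by
      rw [← span_union, ← Set.image_singleton, ← Set.image_union]
      congr 2
      ext j
      simp [Fin.ext_iff]
      omega
    have htoNat : (n - 1).toNat = n.toNat - 1 := by omega
    have h := length_quotient_sup_eq_add (J := span (x '' {j | (j : ℕ) < k}))
      (A := prodFiltration I₁ I₂ n) (B := prodFiltration I₁ I₂ (n - 1)) (y := x ⟨k, hk⟩)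
      (fun b hb => by
        have := mul_mem_prodFiltration (hx ⟨k, hk⟩) n 0 (y := b) (by simpa using hb)
        simpa using this)
      (fun r hr => hreg ⟨k, hk⟩ r hr)
      (fun r hr => by
        have := hN n.toNat (by omega) r hr
        rwa [← htoNat] at this)
    rw [hJ] at h
    have hne : ∀ (k : ℕ) (m : ℤ), Module.length R (R ⧸
        (span (x '' {j | (j : ℕ) < k}) ⊔ prodFiltration I₁ I₂ m)) ≠ ⊤ := fun k m =>
      ne_top_of_le_ne_top (hfin m) (Module.length_le_of_surjective (Submodule.factor le_sup_right)
        (Submodule.factor_surjective _))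
    simp only [backwardDiff, hF]
    rw [h, ENat.toNat_add (hne _ _) (hne _ _)]
    push_cast
    ring
  have hiter : ∀ k ≤ d, backwardDiff^[k] (F 0) =ᶠ[atTop] F k := by
    intro k hk
    induction k with
    | zero => rfl
    | succ k ih =>
      rw [Function.iterate_succ_apply']
      exact (backwardDiff_iterate_eventuallyEq (ih (by omega)) 1).trans (hstep k (by omega))
  have hF0 : F 0 = fun m : ℤ => (hilbertFn I₁ I₂ m : ℚ) := by
    funext m
    have hbot : span (x '' {j | (j : ℕ) < 0}) ⊔ prodFiltration I₁ I₂ m =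
        prodFiltration I₁ I₂ m := by
      refine sup_eq_right.mpr (span_le.mpr ?_)
      rintro _ ⟨j, hj, rfl⟩
      exact absurd hj (Nat.not_lt_zero _)
    simp only [hF]
    rw [hbot, hilbertFn]
  obtain ⟨r, hr⟩ := hpow
  have h := hiter d le_rfl
  rw [hF0] at h
  filter_upwards [h, eventually_ge_atTop (r : ℤ)] with n hn hrn
  rw [hn]
  have huniv : x '' {j | (j : ℕ) < d} = Set.range x := by
    rw [← Set.image_univ]
    congr 1
    ext j
    simp
  have hle : prodFiltration I₁ I₂ n ≤ span (Set.range x) :=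
    Ideal.mul_le_right.trans ((Ideal.pow_le_pow_right (show r ≤ n.toNat by omega)).trans hr)
  simp only [hF]
  rw [huniv, sup_eq_left.mpr hle]

end Ideal

end

/-! ### The Hilbert polynomial and the main theorem. -/

open Filter in
theorem Ideal.isHilbertPolynomial_iff {R : Type u} [CommRing R] {I₁ I₂ : Ideal R}
    {P : Polynomial ℚ} : I₁.IsHilbertPolynomial I₂ P ↔
      ∀ᶠ n : ℤ in atTop, P.eval (n : ℚ) = (hilbertFn I₁ I₂ n : ℚ) :=
  eventually_atTop.symm

/-- Since `toNat` sends `⊤` to `0`, the separate finiteness clauses are what make the two equalities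
statements about actual lengths. -/
theorem mainTheorem1 {R : Type u} [CommRing R] [IsLocalRing R] (hR : IsCohenMacaulayLocalRing R)
    (d : ℕ) (hd : 2 ≤ d) (hdim : ringKrullDim R = (d : WithBot ℕ∞))
    (I₁ I₂ : Ideal R) (hI₁ : I₁.IsMaximalIdealPrimary) (hI₂ : I₂.IsMaximalIdealPrimary)
    (x : Fin d → R) (hx : ∀ j, x j ∈ I₂)
    (hred : (Ideal.span (Set.range x)).IsMinimalReduction I₂)
    (hsup : Ideal.IsSuperficialSequence x I₂ I₁) :
    (∀ n : ℤ, Module.length R (R ⧸ Ideal.prodFiltration I₁ I₂ n) ≠ ⊤) ∧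
    (∃! P : Polynomial ℚ, Ideal.IsHilbertPolynomial I₁ I₂ P) ∧
    ∀ P : Polynomial ℚ, Ideal.IsHilbertPolynomial I₁ I₂ P → ∀ n : ℤ, 1 ≤ n →
      (∀ i : ℕ, Module.length R (Ideal.koszulFiltHomology I₁ I₂ x hx n i) ≠ ⊤) ∧
      Ideal.quotLength (Ideal.prodFiltration I₁ I₂ n ⊔ Ideal.span (Set.range x))
        (Ideal.span (Set.range x)) ≠ ⊤ ∧
      Ideal.quotLength (Ideal.prodFiltration I₁ I₂ n)
        (Ideal.span (Set.range x) * Ideal.prodFiltration I₁ I₂ (n - 1)) ≠ ⊤ ∧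
      backwardDiff^[d] (fun m : ℤ => P.eval (m : ℚ) - (Ideal.hilbertFn I₁ I₂ m : ℚ)) n =
        ((Ideal.quotLength (Ideal.prodFiltration I₁ I₂ n ⊔ Ideal.span (Set.range x))
          (Ideal.span (Set.range x))).toNat : ℚ)
          - ∑ i ∈ Finset.Icc 1 d, (-1 : ℚ) ^ i * (Ideal.koszulFiltLength I₁ I₂ x hx n i : ℚ) ∧
      backwardDiff^[d] (fun m : ℤ => P.eval (m : ℚ) - (Ideal.hilbertFn I₁ I₂ m : ℚ)) n =
        ((Ideal.quotLength (Ideal.prodFiltration I₁ I₂ n)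
          (Ideal.span (Set.range x) * Ideal.prodFiltration I₁ I₂ (n - 1))).toNat : ℚ)
          - ∑ i ∈ Finset.Icc 2 d, (-1 : ℚ) ^ i * (Ideal.koszulFiltLength I₁ I₂ x hx n i : ℚ) := by
  have := hR.isNoetherianRing
  obtain ⟨hJle, r, hr⟩ := hred.prop
  -- The reduction equation puts a power of `I₂` inside `(x)`, so `(x)` and `I₂` have the same
  -- radical, the maximal ideal. The `d = dim R` elements `x` therefore form a regular sequence.
  have hpow : I₂ ^ (r + 1) ≤ Ideal.span (Set.range x) := hr ▸ Ideal.mul_le_left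
  have hrad : (Ideal.span (Set.range x)).radical = IsLocalRing.maximalIdeal R := by
    refine le_antisymm ((Ideal.radical_mono hJle).trans hI₂.2.le) ?_
    rw [← hI₂.2, ← Ideal.radical_pow I₂ r.succ_ne_zero]
    exact Ideal.radical_mono hpow
  have hreg : ∀ i r, x i * r ∈ Ideal.span (x '' {j | j < i}) → r ∈ Ideal.span (x '' {j | j < i}) :=
    fun i r h => hR.mem_of_mul_mem hdim x hrad i h
  have hfin : ∀ n : ℤ, Module.length R (R ⧸ Ideal.prodFiltration I₁ I₂ n) ≠ ⊤ := fun n => by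
    obtain ⟨k, hk⟩ := Ideal.exists_pow_le_prodFiltration hI₁ hI₂ n
    exact Ideal.length_quotient_ne_top_of_pow_le hk
  have hev := Ideal.eventually_backwardDiff_iterate_hilbertFn_eq x hx hreg hsup hfin ⟨_, hpow⟩
  refine ⟨hfin, ?_, fun P hP n _ => ?_⟩
  · obtain ⟨P, hP⟩ := Polynomial.exists_eventually_eval_eq d _ _ hev
    refine ⟨P, Ideal.isHilbertPolynomial_iff.mpr hP, fun Q hQ => ?_⟩
    refine Polynomial.eq_of_eventually_eval_intCast_eq ?_
    filter_upwards [Ideal.isHilbertPolynomial_iff.mp hQ, hP] with n h1 h2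
    rw [h1, h2]
  rw [Ideal.isHilbertPolynomial_iff] at hP
  -- The value known for large `n` is transferred to the given `n`.
  have hPconst := Polynomial.backwardDiff_iterate_eval_eq d P
    ((Module.length R (R ⧸ Ideal.span (Set.range x))).toNat : ℚ) (by
      filter_upwards [hev, backwardDiff_iterate_eventuallyEq hP d] with n h1 h2
      rw [h2, h1]) n
  have hle : Ideal.span (Set.range x) * Ideal.prodFiltration I₁ I₂ (n - 1) ≤
      Ideal.prodFiltration I₁ I₂ n := by
    rw [Ideal.mul_le]
    intro a ha y hy
    simpa using Ideal.mul_mem_prodFiltration (hJle ha) n 0 (y := y) (by simpa using hy)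
  obtain ⟨k, hk⟩ : ∃ k, IsLocalRing.maximalIdeal R ^ k ≤ Ideal.span (Set.range x) :=
    hrad ▸ Ideal.exists_radical_pow_le_of_fg _ (IsNoetherian.noetherian _)
  have hfinJ : Module.length R (R ⧸ Ideal.span (Set.range x)) ≠ ⊤ :=
    Ideal.length_quotient_ne_top_of_pow_le hk
  have hfinJB : Module.length R (R ⧸ Ideal.span (Set.range x) *
      Ideal.prodFiltration I₁ I₂ (n - 1)) ≠ ⊤ := by
    obtain ⟨l, hl⟩ := Ideal.exists_pow_le_prodFiltration hI₁ hI₂ (n - 1)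
    refine Ideal.length_quotient_ne_top_of_pow_le (k := k + l) ?_
    rw [pow_add]
    exact Ideal.mul_mono hk hl
  have hquot1 := Ideal.length_eq_quotLength_add (R := R) (le_sup_right :
    Ideal.span (Set.range x) ≤ Ideal.prodFiltration I₁ I₂ n ⊔ Ideal.span (Set.range x))
  have hquot2 := Ideal.length_eq_quotLength_add hle
  have hne1 : Ideal.quotLength (Ideal.prodFiltration I₁ I₂ n ⊔ Ideal.span (Set.range x))
      (Ideal.span (Set.range x)) ≠ ⊤ := ne_top_of_le_ne_top hfinJ (hquot1 ▸ le_self_add)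
  have hne2 : Ideal.quotLength (Ideal.prodFiltration I₁ I₂ n)
      (Ideal.span (Set.range x) * Ideal.prodFiltration I₁ I₂ (n - 1)) ≠ ⊤ :=
    ne_top_of_le_ne_top hfinJB (hquot2 ▸ le_self_add)
  have hne3 : Module.length R
      (R ⧸ (Ideal.prodFiltration I₁ I₂ n ⊔ Ideal.span (Set.range x))) ≠ ⊤ :=
    ne_top_of_le_ne_top hfinJ (hquot1 ▸ le_add_self)
  have hrange : ∀ f : ℕ → ℚ, ∑ i ∈ Finset.range (d + 1), f i = f 0 + ∑ i ∈ Finset.Icc 1 d, f i := by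
    intro f
    rw [Finset.range_eq_Ico, Finset.sum_eq_sum_Ico_succ_bot (by omega)]
    rfl
  have hIcc : ∀ f : ℕ → ℚ, ∑ i ∈ Finset.Icc 1 d, f i = f 1 + ∑ i ∈ Finset.Icc 2 d, f i :=
    fun f => Finset.sum_eq_sum_Ico_succ_bot (by omega : 1 < d + 1) f
  have hfirst : backwardDiff^[d]
      (fun m : ℤ => P.eval (m : ℚ) - (Ideal.hilbertFn I₁ I₂ m : ℚ)) n =
        ((Ideal.quotLength (Ideal.prodFiltration I₁ I₂ n ⊔ Ideal.span (Set.range x))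
          (Ideal.span (Set.range x))).toNat : ℚ)
          - ∑ i ∈ Finset.Icc 1 d, (-1 : ℚ) ^ i * (Ideal.koszulFiltLength I₁ I₂ x hx n i : ℚ) := by
    rw [backwardDiff_iterate_sub, hPconst, backwardDiff_iterate_eq_sum,
      Ideal.sum_choose_mul_hilbertFn_eq x hx n hfin, hrange, Ideal.koszulFiltLength,
      Ideal.length_koszulFiltHomology_zero x hx n hfin, hquot1, ENat.toNat_add hne1 hne3]
    push_cast
    ring
  refine ⟨Ideal.length_koszulFiltHomology_ne_top x hx n hfin, hne1, hne2, hfirst, ?_⟩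
  -- The term `i = 1` contributes `+h_1`, which is absorbed into the leading length.
  rw [hfirst, hIcc,
    ← Ideal.quotLength_add_koszulFiltLength_one x hx n hreg hfin hfinJB hle]
  push_cast
  ring
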